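/- For each $n\ge 1$ let requests for $n$ unit-size contents $1,\dots,n$ be described by mutually independent stationary and ergodic simple point processes $N_{n,1},\dots,N_{n,n}$ on $\mathbb R$, all on one probability space, with intensities $\lambda_{n,i}\in(0,\infty)$. Put $\Lambda_n=\sum_{i=1}^n\lambda_{n,i}$ and $p_{n,i}=\lambda_{n,i}/\Lambda_n$. Let $\mathbb P^0_{n,i}$ be the Palm probability of $N_{n,i}$, let $\mathbb P^0_n$ be the Palm probability of the superposition $\sum_i N_{n,i}$, and let $G_{n,i}(t)=\mathbb P^0_{n,i}[t_{n,i}(1)\le t]$, where $t_{n,i}(1)$ is the first point of $N_{n,i}$ in $(0,\infty)$. Let $Y_{n,i}(t)=1$ if $N_{n,i}$ has a point in $[-t,0)$ and $Y_{n,i}(t)=0$ otherwise. For an LRU cache of size $C_n$ let $\tau_n=\inf\{t:\sum_{i=1}^n Y_{n,i}(t)\ge C_n\}$, and let $$H_n^{\mathrm{LRU}}=\mathbb P_n^0\big[Y_{n,X_n^0}(\tau_n)=1\big]$$ be the aggregate stationary hit probability, where $X_n^0$ is the content requested at time $0$ under $\mathbb P_n^0$. Assume: 1. $C_n\sim\beta_0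 n$ as $n\to\infty$, for some $\beta_0\in(0,1)$. 2. There is a continuous cdf $\Psi$ with support in $[0,\infty)$ such that $G_{n,i}(t/\lambda_{n,i})=\Psi(t)$ for all $t$ and all $1\le i\le n$. 3. There are a continuous function $f$ on $(0,1]$ with $f>0$ a.e. and $\lim_{x\to0+}f(x)\in[0,+\infty]$, and points $z_{n,i}\in[\frac{i-1}{n},\frac in]$, such that $$\max_{1\le i\le n}\left|\frac{n^{-1}f(z_{n,i})}{p_{n,i}}-1\right|\to0\quad\text{as }n\to\infty.$$ 4. $\int_0^1 f(x)\,dx=1$. Let $\hat\Psi(t)=\frac1{m_\Psi}\int_0^t(1-\Psi(z))\,dz$, where $m_\Psi$ is the mean of $\Psi$. Then there is a unique $\nu_0\in(0,\infty)$ with $$\int_0^1\hat\Psi(\nu_0f(x))\,dx=\beta_0,$$ and $$H_n^{\mathrm{LRU}}\longrightarrow\int_0^1 f(x)\,\Psi(\nu_0f(x))\,dx\quad\text{as }n\to\infty.$$ -/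

import Mathlib

open MeasureTheory ProbabilityTheory Filter Topology Set
open scoped ENNReal

noncomputable section

namespace LRU

/-! ### Point processes on the line

A configuration of points is encoded by its counting measure on `ℝ`; a point process is a random
measure `N : Ω → Measure ℝ`, where `Measure ℝ` carries the σ-algebra generated by the evaluations
`μ ↦ μ B`, `B` Borel. -/

/-- `μ` is the counting measure of a locally finite set of points: every point has mass one
and every bounded interval contains finitely many points. -/
def IsSimpleConfig (μ : Measure ℝ) : Prop :=
  ∃ S : Set ℝ, (∀ a b : ℝ, (S ∩ Icc a b).Finite) ∧ μ = Measure.count.restrict S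

/-- The configuration seen from time `t`: `(shift t μ) B = μ (B + t)`. -/
def shift (t : ℝ) (μ : Measure ℝ) : Measure ℝ := μ.map (fun x => x - t)

variable {Ω : Type*} [MeasurableSpace Ω]

/-- Stationary and ergodic simple point process. -/
structure IsStationaryErgodicSimple (P : Measure Ω) (N : Ω → Measure ℝ) : Prop where
  measurable : Measurable N
  simple : ∀ᵐ ω ∂P, IsSimpleConfig (N ω)
  stationary : ∀ t : ℝ, P.map (fun ω => shift t (N ω)) = P.map N
  ergodic : ∀ A : Set (Measure ℝ), MeasurableSet A → (∀ t : ℝ, shift t ⁻¹' A = A) →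
    P.map N A = 0 ∨ P.map N A = 1

/-- Intensity: the expected number of points in `(0, 1]`. -/
def intensity (P : Measure Ω) (N : Ω → Measure ℝ) : ℝ≥0∞ :=
  ∫⁻ ω, N ω (Ioc 0 1) ∂P

/-- Palm probability, with respect to the point process `M`, of an event `A` about the family of
configurations `N = (N i)_i`:
`P⁰(A) = E[ #{points s of M in (0, 1] : A holds for N seen from s} ] / intensity of M`. -/
def palm {ι : Type*} (P : Measure Ω) (N : ι → Ω → Measure ℝ) (M : Ω → Measure ℝ)
    (A : Set (ι → Measure ℝ)) : ℝ≥0∞ :=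
  (∫⁻ ω, ∫⁻ s in Ioc 0 1, A.indicator 1 (fun i => shift s (N i ω)) ∂(M ω) ∂P) / intensity P M

/-- The first point `t(1) ∈ (0, ∞]` after time `0`, equal to `∞` if there is none. -/
def nextPoint (μ : Measure ℝ) : EReal :=
  sInf ((fun x : ℝ => (x : EReal)) '' {x : ℝ | 0 < x ∧ μ {x} ≠ 0})

/-! ### The LRU cache -/

/-- `Y_i(T) = 1`: the configuration `μ` has a point (a request) in `[-T, 0)`. -/
def RequestedWithin (μ : Measure ℝ) (T : EReal) : Prop :=
  ∃ x : ℝ, μ {x} ≠ 0 ∧ -T ≤ (x : EReal) ∧ x < 0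

/-- `Y(T)`: the number of distinct contents requested during `[-T, 0)`. -/
def numRequested {ι : Type*} (μ : ι → Measure ℝ) (T : EReal) : ℕ :=
  {i : ι | RequestedWithin (μ i) T}.ncard

/-- `τ = inf {T : Y(T) ≥ C}`, for a cache of size `C`. -/
def evictionTime {ι : Type*} (C : ℝ) (μ : ι → Measure ℝ) : EReal :=
  sInf {T : EReal | C ≤ (numRequested μ T : ℝ)}

/-- A content `i` is requested at time `0` and this request is a hit for an LRU cache of
size `C`: content `i` is requested during `[-τ, 0)`. -/
def lruHitEvent {ι : Type*} (C : ℝ) : Set (ι → Measure ℝ) :=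
  {μ | ∃ i, μ i {0} ≠ 0 ∧ RequestedWithin (μ i) (evictionTime C μ)}

/-- The aggregate stationary LRU hit probability, under the Palm probability of the superposition
of all the request processes. -/
def hitProbLRU {n : ℕ} (P : Measure Ω) (N : Fin n → Ω → Measure ℝ) (C : ℝ) : ℝ :=
  (palm P N (fun ω => ∑ i, N i ω) (lruHitEvent C)).toReal

/-- Request rate `λ_i` of content `i`. -/
def rate {n : ℕ} (P : Measure Ω) (N : Fin n → Ω → Measure ℝ) (i : Fin n) : ℝ :=
  (intensity P (N i)).toReal

/-- Popularity `p_i = λ_i / ∑_j λ_j` of content `i`. -/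
def popularity {n : ℕ} (P : Measure Ω) (N : Fin n → Ω → Measure ℝ) (i : Fin n) : ℝ :=
  rate P N i / ∑ j, rate P N j

/-- Inter-request cdf `G_i(t) = P⁰_i[t_i(1) ≤ t]` of content `i`. -/
def interRequestCdf {n : ℕ} (P : Measure Ω) (N : Fin n → Ω → Measure ℝ) (i : Fin n) (t : ℝ) : ℝ :=
  (palm P N (N i) {μ | nextPoint (μ i) ≤ (t : EReal)}).toReal

/-- Standardized inter-request cdf `G*_i(t) = G_i(t / λ_i)`. -/
def stdInterRequestCdf {n : ℕ} (P : Measure Ω) (N : Fin n → Ω → Measure ℝ) (i : Fin n)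
    (t : ℝ) : ℝ :=
  interRequestCdf P N i (t / rate P N i)

/-- For every `n`, the requests for contents `1, …, n` form mutually independent stationary and
ergodic simple point processes with positive finite intensities. -/
structure IsRequestModel (P : Measure Ω) (N : ∀ n : ℕ, Fin n → Ω → Measure ℝ) : Prop where
  indep : ∀ n, iIndepFun (N n) P
  process : ∀ n i, IsStationaryErgodicSimple P (N n i)
  intensity_pos : ∀ n i, 0 < intensity P (N n i)
  intensity_lt_top : ∀ n i, intensity P (N n i) < ⊤

/-- `F̂(t) = (1 / m_F) ∫_0^t (1 - F(z)) dz`, where `F` is the cdf of `ψ` and `m_F` its mean. -/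
def hatCdf (ψ : Measure ℝ) (t : ℝ) : ℝ :=
  (1 / ∫ x, x ∂ψ) * ∫ z in (0 : ℝ)..t, (1 - cdf ψ z)

/-- Fagin's condition: `f` is continuous on `(0, 1]`, positive a.e., has a limit in `[0, ∞]` at
`0+`, and `p_{n,i} ~ g_n f(z_{n,i})` uniformly in `i`, for some points `z_{n,i}` of the `i`-th of
the `n` intervals of length `1/n`. (The indices `i` start from `0` here.) -/
def FaginCondition (p : ∀ n : ℕ, Fin n → ℝ) (g : ℕ → ℝ) (f : ℝ → ℝ) : Prop :=
  ContinuousOn f (Ioc 0 1) ∧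
  (∀ᵐ x ∂(volume.restrict (Ioc (0 : ℝ) 1)), 0 < f x) ∧
  ((∃ L : ℝ, 0 ≤ L ∧ Tendsto f (𝓝[>] 0) (𝓝 L)) ∨ Tendsto f (𝓝[>] 0) atTop) ∧
  ∃ z : ∀ n : ℕ, Fin n → ℝ,
    (∀ n (i : Fin n), z n i ∈ Icc ((i : ℝ) / n) (((i : ℝ) + 1) / n)) ∧
    ∀ ε > 0, ∀ᶠ n in atTop, ∀ i : Fin n, |g n * f (z n i) / p n i - 1| < ε

end LRU

end

namespace LRU

/-! ### Locally finite configurations -/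

/-! The proof makes the characteristic-time heuristic rigorous. In a window of length `ν * n / Λ`
the number of distinct requested contents is a sum of `n` independent indicators. By the
Palm–Khinchin relation (`toReal_hitWithin`) its mean is the sum of `excessCdf ψ (ν * (n * p i))`,
and by Chebyshev (`measure_activeCount_deviation_le`) it deviates from this by `o(n)`. Fagin's
condition turns the mean into `n` times the integral of `excessCdf ψ (ν * f x)`
(`tendsto_average_of_fagin`), which crosses the level `β₀` exactly at `ν₀`
(`exists_characteristic_time`). Hence the eviction time lies, with high probability, between the
windows for any `ν < ν₀` and any `ν > ν₀`. For a deterministic window a hit on content `i` means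
that the previous request for `i` is recent enough, which has Palm probability `cdf ψ (ν * (n * p
i))` (`toReal_precededMean`). Averaging with weights `p i`, passing to the limit
(`tendsto_weighted_sum_of_fagin`) and letting `ν` tend to `ν₀` from both sides gives the result.

Palm calculus is replaced by counting in cells of length `1 / m`. Up to one boundary effect, a cell
contains at most one point with no successor within time `t`, and it contains one when the cell is
hit and a gap of length about `t` comes after it. Since such a gap event is a difference of two
hitting events, Palm quantities are squeezed between increments of `hitWithin`. The same counts run
backwards give the law of the time since the previous request. Cells also decouple the contents:
windows attached to the cell, rather than to the request, make the count of the other contents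
independent of the requests for `i` in that cell. -/

/-- Integrals over bounded intervals become finite sums over atoms, for arbitrary `g`. This is what
lets the random sets `followed` and `preceded` be integrated without any measurability. -/
lemma IsSimpleConfig.exists_finset {μ : Measure ℝ} (hμ : IsSimpleConfig μ) (a b : ℝ) :
    ∃ F : Finset ℝ, (∀ x, x ∈ F ↔ x ∈ Ioc a b ∧ μ {x} ≠ 0) ∧
      ∀ g : ℝ → ℝ≥0∞, ∫⁻ s in Ioc a b, g s ∂μ = ∑ s ∈ F, g s := by
  obtain ⟨S, hS, rfl⟩ := hμ
  have hfin : (Ioc a b ∩ S).Finite :=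
    (hS a b).subset fun x hx => ⟨hx.2, Ioc_subset_Icc_self hx.1⟩
  refine ⟨hfin.toFinset, fun x => ?_, fun g => ?_⟩
  · rw [hfin.mem_toFinset, Measure.restrict_apply (measurableSet_singleton x)]
    by_cases hx : x ∈ S <;> simp [hx]
  · rw [Measure.restrict_restrict measurableSet_Ioc]
    conv_lhs => rw [← hfin.coe_toFinset]
    rw [lintegral_finset]
    simp

lemma IsSimpleConfig.ne_zero_iff {μ : Measure ℝ} (hμ : IsSimpleConfig μ) {B : Set ℝ}
    (hB : MeasurableSet B) : μ B ≠ 0 ↔ ∃ x ∈ B, μ {x} ≠ 0 := by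
  refine ⟨fun h => ?_, fun ⟨x, hx, h⟩ h0 => h (measure_mono_null (singleton_subset_iff.2 hx) h0)⟩
  obtain ⟨S, -, rfl⟩ := hμ
  rw [Measure.restrict_apply hB, Measure.count_ne_zero_iff] at h
  obtain ⟨x, hxB, hxS⟩ := h
  refine ⟨x, hxB, ?_⟩
  rw [Measure.restrict_apply (measurableSet_singleton x)]
  simp [hxS]

lemma IsSimpleConfig.eq_zero_iff {μ : Measure ℝ} (hμ : IsSimpleConfig μ) {B : Set ℝ}
    (hB : MeasurableSet B) : μ B = 0 ↔ ∀ x ∈ B, μ {x} = 0 := by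
  have := hμ.ne_zero_iff hB
  contrapose! this
  tauto

/-- The finite set `G` collects the exceptional points, those outside `W`. The additive form avoids
subtraction in `ℝ≥0∞`. -/
lemma IsSimpleConfig.lintegral_indicator_Ioc {μ : Measure ℝ} (hμ : IsSimpleConfig μ) (a b : ℝ)
    (W : Set ℝ) :
    ∃ F G : Finset ℝ, (∀ x, x ∈ F ↔ x ∈ Ioc a b ∧ μ {x} ≠ 0) ∧ (∀ x, x ∈ G ↔ x ∈ F ∧ x ∉ W) ∧
      ∫⁻ s in Ioc a b, W.indicator 1 s ∂μ + (G.card : ℝ≥0∞) = μ (Ioc a b) := by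
  classical
  obtain ⟨F, hF, hint⟩ := hμ.exists_finset a b
  refine ⟨F, F.filter (· ∉ W), hF, fun x => Finset.mem_filter, ?_⟩
  have h1 : μ (Ioc a b) = F.card := by
    rw [← setLIntegral_one, hint]
    simp
  rw [h1, hint, ← F.card_filter_add_card_filter_not (· ∈ W), Nat.cast_add]
  congr 1
  simp [Set.indicator_apply]

lemma shift_apply (t : ℝ) (μ : Measure ℝ) {B : Set ℝ} (hB : MeasurableSet B) :
    shift t μ B = μ ((fun x => x - t) ⁻¹' B) :=
  Measure.map_apply (measurable_id.sub_const t) hB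

lemma shift_singleton (t : ℝ) (μ : Measure ℝ) (x : ℝ) : shift t μ {x} = μ {x + t} := by
  rw [shift_apply t μ (measurableSet_singleton x)]
  congr 1
  ext y
  simp [sub_eq_iff_eq_add]

lemma shift_Ioc (t : ℝ) (μ : Measure ℝ) (a b : ℝ) : shift t μ (Ioc a b) = μ (Ioc (a + t) (b + t)) := by
  rw [shift_apply t μ measurableSet_Ioc]
  simp

/-- The points of `μ` followed by another point within time `t`. -/
def followed (t : ℝ) (μ : Measure ℝ) : Set ℝ := {s | ∃ x, s < x ∧ x ≤ s + t ∧ μ {x} ≠ 0}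

/-- The times preceded by a point of `μ` within time `t`. -/
def preceded (t : ℝ) (μ : Measure ℝ) : Set ℝ := {s | ∃ x, s - t ≤ x ∧ x < s ∧ μ {x} ≠ 0}

/-- Configurations with a point in `(a, b]` and none in `(c, d]`. -/
def gapSet (a b c d : ℝ) : Set (Measure ℝ) := {μ | μ (Ioc a b) ≠ 0 ∧ μ (Ioc c d) = 0}

lemma measurableSet_gapSet (a b c d : ℝ) : MeasurableSet (gapSet a b c d) :=
  ((Measure.measurable_coe measurableSet_Ioc (measurableSet_singleton 0)).compl).inter
    (Measure.measurable_coe measurableSet_Ioc (measurableSet_singleton 0))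

/-! ### Points without a close successor or predecessor, counted in one cell -/

section Cell

variable {μ : Measure ℝ} (hμ : IsSimpleConfig μ) (u h t : ℝ)
include hμ

/-- When the cell is hit and nothing comes for time `t` after its right end, the last point of the
cell has no successor within `t`. -/
lemma followed_add_gap_le :
    ∫⁻ s in Ioc u (u + h), (followed t μ).indicator 1 s ∂μ +
      (gapSet u (u + h) (u + h) (u + h + t)).indicator 1 μ ≤ μ (Ioc u (u + h)) := by
  obtain ⟨F, G, hF, hG, hint⟩ := hμ.lintegral_indicator_Ioc u (u + h) (followed t μ)
  rw [← hint]
  gcongr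
  by_cases hgap : μ ∈ gapSet u (u + h) (u + h) (u + h + t)
  · rw [indicator_of_mem hgap, Pi.one_apply]
    obtain ⟨x, hx, hx0⟩ := (hμ.ne_zero_iff measurableSet_Ioc).1 hgap.1
    have hne : F.Nonempty := ⟨x, (hF x).2 ⟨hx, hx0⟩⟩
    have hmax := (hF _).1 (F.max'_mem hne)
    have : F.max' hne ∈ G := by
      refine (hG _).2 ⟨F.max'_mem hne, ?_⟩
      rintro ⟨y, hy1, hy2, hy0⟩
      by_cases hyu : y ≤ u + h
      · exact absurd (F.le_max' y ((hF y).2 ⟨⟨hmax.1.1.trans hy1, hyu⟩, hy0⟩)) (not_le.2 hy1)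
      · refine hy0 ((hμ.eq_zero_iff measurableSet_Ioc).1 hgap.2 y ⟨not_le.1 hyu, ?_⟩)
        linarith [hmax.1.2]
    exact_mod_cast Finset.card_pos.2 ⟨_, this⟩
  · simp [hgap]

/-- Two points of a cell of length `h ≤ t` cannot both lack a successor within `t`, since the later
one follows the earlier. If one point lacks it, the stretch from the cell's end up to `u + t` is
empty. -/
lemma le_followed_add_gap (hht : h ≤ t) :
    μ (Ioc u (u + h)) ≤ ∫⁻ s in Ioc u (u + h), (followed t μ).indicator 1 s ∂μ +
      (gapSet u (u + h) (u + h) (u + t)).indicator 1 μ := by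
  obtain ⟨F, G, hF, hG, hint⟩ := hμ.lintegral_indicator_Ioc u (u + h) (followed t μ)
  rw [← hint]
  gcongr
  have key : ∀ x ∈ G, ∀ y, x < y → y ≤ x + t → μ {y} = 0 := fun x hx y h1 h2 => by
    by_contra h0
    exact ((hG x).1 hx).2 ⟨y, h1, h2, h0⟩
  have hle : G.card ≤ 1 := by
    refine Finset.card_le_one.2 fun x hx y hy => ?_
    have hx' := (hF x).1 ((hG x).1 hx).1
    have hy' := (hF y).1 ((hG y).1 hy).1
    rcases lt_trichotomy x y with hxy | hxy | hxy
    · exact absurd (key x hx y hxy (by linarith [hx'.1.1, hy'.1.2])) hy'.2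
    · exact hxy
    · exact absurd (key y hy x hxy (by linarith [hy'.1.1, hx'.1.2])) hx'.2
  rcases G.eq_empty_or_nonempty with rfl | ⟨x, hx⟩
  · simp
  · have hx' := (hF x).1 ((hG x).1 hx).1
    have hgap : μ ∈ gapSet u (u + h) (u + h) (u + t) := by
      refine ⟨(hμ.ne_zero_iff measurableSet_Ioc).2 ⟨x, hx'⟩,
        (hμ.eq_zero_iff measurableSet_Ioc).2 fun y hy => key x hx y ?_ ?_⟩
      · linarith [hx'.1.2, hy.1]
      · linarith [hx'.1.1, hy.2]
    rw [indicator_of_mem hgap, Pi.one_apply]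
    exact_mod_cast hle

lemma preceded_add_gap_le :
    ∫⁻ s in Ioc u (u + h), (preceded t μ).indicator 1 s ∂μ +
      (gapSet u (u + h) (u - t) u).indicator 1 μ ≤ μ (Ioc u (u + h)) := by
  obtain ⟨F, G, hF, hG, hint⟩ := hμ.lintegral_indicator_Ioc u (u + h) (preceded t μ)
  rw [← hint]
  gcongr
  by_cases hgap : μ ∈ gapSet u (u + h) (u - t) u
  · rw [indicator_of_mem hgap, Pi.one_apply]
    obtain ⟨x, hx, hx0⟩ := (hμ.ne_zero_iff measurableSet_Ioc).1 hgap.1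
    have hne : F.Nonempty := ⟨x, (hF x).2 ⟨hx, hx0⟩⟩
    have hmin := (hF _).1 (F.min'_mem hne)
    have : F.min' hne ∈ G := by
      refine (hG _).2 ⟨F.min'_mem hne, ?_⟩
      rintro ⟨y, hy1, hy2, hy0⟩
      by_cases hyu : y ≤ u
      · refine hy0 ((hμ.eq_zero_iff measurableSet_Ioc).1 hgap.2 y ⟨?_, hyu⟩)
        linarith [hmin.1.1]
      · exact absurd (F.min'_le y ((hF y).2 ⟨⟨not_le.1 hyu, hy2.le.trans hmin.1.2⟩, hy0⟩))
          (not_le.2 hy2)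
    exact_mod_cast Finset.card_pos.2 ⟨_, this⟩
  · simp [hgap]

lemma le_preceded_add_gap (hht : h ≤ t) :
    μ (Ioc u (u + h)) ≤ ∫⁻ s in Ioc u (u + h), (preceded t μ).indicator 1 s ∂μ +
      (gapSet u (u + h) (u + h - t) u).indicator 1 μ := by
  obtain ⟨F, G, hF, hG, hint⟩ := hμ.lintegral_indicator_Ioc u (u + h) (preceded t μ)
  rw [← hint]
  gcongr
  have key : ∀ x ∈ G, ∀ y, x - t ≤ y → y < x → μ {y} = 0 := fun x hx y h1 h2 => by
    by_contra h0
    exact ((hG x).1 hx).2 ⟨y, h1, h2, h0⟩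
  have hle : G.card ≤ 1 := by
    refine Finset.card_le_one.2 fun x hx y hy => ?_
    have hx' := (hF x).1 ((hG x).1 hx).1
    have hy' := (hF y).1 ((hG y).1 hy).1
    rcases lt_trichotomy x y with hxy | hxy | hxy
    · exact absurd (key y hy x (by linarith [hx'.1.1, hy'.1.2]) hxy) hx'.2
    · exact hxy
    · exact absurd (key x hx y (by linarith [hy'.1.1, hx'.1.2]) hxy) hy'.2
  rcases G.eq_empty_or_nonempty with rfl | ⟨x, hx⟩
  · simp
  · have hx' := (hF x).1 ((hG x).1 hx).1
    have hgap : μ ∈ gapSet u (u + h) (u + h - t) u := by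
      refine ⟨(hμ.ne_zero_iff measurableSet_Ioc).2 ⟨x, hx'⟩,
        (hμ.eq_zero_iff measurableSet_Ioc).2 fun y hy => key x hx y ?_ ?_⟩
      · linarith [hx'.1.2, hy.1]
      · linarith [hx'.1.1, hy.2]
    rw [indicator_of_mem hgap, Pi.one_apply]
    exact_mod_cast hle

end Cell

lemma IsSimpleConfig.nextPoint_shift_le_iff {μ : Measure ℝ} (hμ : IsSimpleConfig μ) (s t : ℝ) :
    nextPoint (shift s μ) ≤ (t : EReal) ↔ s ∈ followed t μ := by
  have hmem : ∀ x : ℝ, x ∈ {x : ℝ | 0 < x ∧ shift s μ {x} ≠ 0} ↔ 0 < x ∧ μ {x + s} ≠ 0 :=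
    fun x => by rw [← shift_singleton]; rfl
  constructor
  · intro hle
    by_contra hnot
    have hnot' : ∀ x, s < x → x ≤ s + t → μ {x} = 0 := fun x h1 h2 => by
      by_contra h0
      exact hnot ⟨x, h1, h2, h0⟩
    -- The extra length `1` provides a strict margin: local finiteness gives a first point in this
    -- window, or none at all, so the infimum stays strictly above `t`.
    obtain ⟨F, hF, -⟩ := hμ.exists_finset s (s + t + 1)
    obtain ⟨c, htc, hc⟩ : ∃ c : ℝ, t < c ∧ ∀ x : ℝ, 0 < x → μ {x + s} ≠ 0 → c ≤ x := by
      rcases F.eq_empty_or_nonempty with rfl | hne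
      · refine ⟨t + 1, by linarith, fun x hx h0 => ?_⟩
        by_contra! hlt
        exact Finset.notMem_empty _ ((hF (x + s)).2 ⟨⟨by linarith, by linarith⟩, h0⟩)
      · have hmin := (hF _).1 (F.min'_mem hne)
        refine ⟨F.min' hne - s, ?_, fun x hx h0 => ?_⟩
        · by_contra! hlt
          exact hmin.2 (hnot' _ hmin.1.1 (by linarith))
        · by_contra! hlt
          have := F.min'_le (x + s) ((hF _).2 ⟨⟨by linarith, by linarith [hmin.1.2]⟩, h0⟩)
          linarith
    have : (c : EReal) ≤ nextPoint (shift s μ) := by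
      refine le_sInf ?_
      rintro _ ⟨x, hx, rfl⟩
      rw [hmem] at hx
      exact EReal.coe_le_coe_iff.2 (hc x hx.1 hx.2)
    exact absurd (EReal.coe_le_coe_iff.1 (this.trans hle)) (not_le.2 htc)
  · rintro ⟨x, h1, h2, h0⟩
    refine (sInf_le (mem_image_of_mem _ ((hmem (x - s)).2 ⟨by linarith, by simpa using h0⟩))).trans ?_
    exact EReal.coe_le_coe_iff.2 (by linarith)

lemma lintegral_Ioc_eq_sum_cells (μ : Measure ℝ) (g : ℝ → ℝ≥0∞) {m : ℕ} (hm : 0 < m) :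
    ∫⁻ s in Ioc 0 1, g s ∂μ =
      ∑ k ∈ Finset.range m, ∫⁻ s in Ioc ((k : ℝ) / m) (k / m + 1 / m), g s ∂μ := by
  have hm' : (0 : ℝ) < m := by exact_mod_cast hm
  have key : ∀ k : ℕ, ∫⁻ s in Ioc (0 : ℝ) (k / m), g s ∂μ =
      ∑ j ∈ Finset.range k, ∫⁻ s in Ioc ((j : ℝ) / m) (j / m + 1 / m), g s ∂μ := by
    intro k
    induction k with
    | zero => simp
    | succ k ih =>
      have hle : (k : ℝ) / m ≤ k / m + 1 / m := by linarith [one_div_pos.2 hm']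
      have h0 : 0 ≤ (k : ℝ) / m := by positivity
      rw [Finset.sum_range_succ, ← ih, ← lintegral_union measurableSet_Ioc,
        Ioc_union_Ioc_eq_Ioc h0 hle]
      · push_cast
        rw [add_div]
      · rw [disjoint_iff_inter_eq_empty, Ioc_inter_Ioc]
        simp
  rw [← key m, div_self hm'.ne']

variable {Ω : Type*} [MeasurableSpace Ω] {P : Measure Ω} {N : Ω → Measure ℝ}

/-! ### One stationary point process -/

/-- The probability that the process has a point in an interval of length `t`. -/
def hitWithin (P : Measure Ω) (N : Ω → Measure ℝ) (t : ℝ) : ℝ≥0∞ :=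
  P {ω | N ω (Ioc 0 t) ≠ 0}

/-- The mean number of points in `(0, 1]` followed by another point within time `t`. -/
noncomputable def followedMean (P : Measure Ω) (N : Ω → Measure ℝ) (t : ℝ) : ℝ≥0∞ :=
  ∫⁻ ω, ∫⁻ s in Ioc 0 1, (followed t (N ω)).indicator 1 s ∂(N ω) ∂P

/-- The mean number of points in `(0, 1]` preceded by another point within time `t`. -/
noncomputable def precededMean (P : Measure Ω) (N : Ω → Measure ℝ) (t : ℝ) : ℝ≥0∞ :=
  ∫⁻ ω, ∫⁻ s in Ioc 0 1, (preceded t (N ω)).indicator 1 s ∂(N ω) ∂P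

lemma measurable_shift (t : ℝ) : Measurable (shift t) :=
  Measure.measurable_map _ (measurable_id.sub_const t)

lemma measurableSet_apply_ne_zero {B : Set ℝ} (hB : MeasurableSet B) :
    MeasurableSet {μ : Measure ℝ | μ B ≠ 0} :=
  (Measure.measurable_coe hB (measurableSet_singleton 0)).compl

namespace IsStationaryErgodicSimple

variable (hN : IsStationaryErgodicSimple P N)
include hN

lemma measurable_apply {B : Set ℝ} (hB : MeasurableSet B) : Measurable fun ω => N ω B :=
  (Measure.measurable_coe hB).comp hN.measurable

lemma measurableSet_ne_zero {B : Set ℝ} (hB : MeasurableSet B) :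
    MeasurableSet {ω | N ω B ≠ 0} :=
  hN.measurable (measurableSet_apply_ne_zero hB)

lemma measurable_shift_apply (a : ℝ) : Measurable fun ω => shift a (N ω) :=
  (measurable_shift a).comp hN.measurable

lemma measure_Ioc_ne_zero (a b : ℝ) : P {ω | N ω (Ioc a b) ≠ 0} = hitWithin P N (b - a) := by
  have hms := measurableSet_apply_ne_zero (measurableSet_Ioc (a := (0 : ℝ)) (b := b - a))
  have h := congrArg (· {μ : Measure ℝ | μ (Ioc 0 (b - a)) ≠ 0}) (hN.stationary a)
  beta_reduce at h
  rw [Measure.map_apply (hN.measurable_shift_apply a) hms,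
    Measure.map_apply hN.measurable hms] at h
  rw [hitWithin]
  refine Eq.trans ?_ h
  congr 1
  ext ω
  change _ ↔ shift a (N ω) (Ioc 0 (b - a)) ≠ 0
  rw [shift_Ioc, zero_add, sub_add_cancel]
  rfl

lemma lintegral_Ioc (a b : ℝ) : ∫⁻ ω, N ω (Ioc a b) ∂P = ∫⁻ ω, N ω (Ioc 0 (b - a)) ∂P := by
  have hm := Measure.measurable_coe (measurableSet_Ioc (a := (0 : ℝ)) (b := b - a))
  have h := congrArg (fun κ => ∫⁻ μ, μ (Ioc 0 (b - a)) ∂κ) (hN.stationary a)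
  beta_reduce at h
  rw [lintegral_map hm (hN.measurable_shift_apply a),
    lintegral_map hm hN.measurable] at h
  rw [← h]
  simp [shift_Ioc]

lemma lintegral_cell {m : ℕ} (hm : 0 < m) (a : ℝ) :
    (m : ℝ≥0∞) * ∫⁻ ω, N ω (Ioc a (a + 1 / m)) ∂P = intensity P N := by
  have h (ω) : N ω (Ioc 0 1) =
      ∑ k ∈ Finset.range m, N ω (Ioc ((k : ℝ) / m) (k / m + 1 / m)) := by
    simpa using lintegral_Ioc_eq_sum_cells (N ω) 1 hm
  rw [intensity]
  simp_rw [h]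
  rw [lintegral_finsetSum _ fun k _ => hN.measurable_apply measurableSet_Ioc]
  simp_rw [hN.lintegral_Ioc _ (_ + _), add_sub_cancel_left]
  simp

/-- The interval `(u, w]` is hit either in `(v, w]` or, failing that, in `(u, v]`; these cases are
disjoint. -/
lemma measure_gap_right {u v w : ℝ} (huv : u ≤ v) (hvw : v ≤ w) :
    P {ω | N ω ∈ gapSet u v v w} + hitWithin P N (w - v) = hitWithin P N (w - u) := by
  rw [← hN.measure_Ioc_ne_zero v w, ← hN.measure_Ioc_ne_zero u w,
    ← measure_union _ (hN.measurableSet_ne_zero measurableSet_Ioc)]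
  · congr 1
    ext ω
    change (N ω (Ioc u v) ≠ 0 ∧ N ω (Ioc v w) = 0) ∨ N ω (Ioc v w) ≠ 0 ↔ N ω (Ioc u w) ≠ 0
    rw [← Ioc_union_Ioc_eq_Ioc huv hvw, ← not_iff_not, not_ne_iff, measure_union_null_iff]
    tauto
  · rw [Set.disjoint_left]
    exact fun ω h1 h2 => h2 h1.2

lemma measure_gap_left {u v w : ℝ} (huv : u ≤ v) (hwu : w ≤ u) :
    P {ω | N ω ∈ gapSet u v w u} + hitWithin P N (u - w) = hitWithin P N (v - w) := by
  rw [← hN.measure_Ioc_ne_zero w u, ← hN.measure_Ioc_ne_zero w v,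
    ← measure_union _ (hN.measurableSet_ne_zero measurableSet_Ioc)]
  · congr 1
    ext ω
    change (N ω (Ioc u v) ≠ 0 ∧ N ω (Ioc w u) = 0) ∨ N ω (Ioc w u) ≠ 0 ↔ N ω (Ioc w v) ≠ 0
    rw [← Ioc_union_Ioc_eq_Ioc hwu huv, ← not_iff_not, not_ne_iff, measure_union_null_iff]
    tauto
  · rw [Set.disjoint_left]
    exact fun ω h1 h2 => h2 h1.2

lemma measurable_indicator {E : Set (Measure ℝ)} (hE : MeasurableSet E) :
    Measurable fun ω => E.indicator (1 : Measure ℝ → ℝ≥0∞) (N ω) :=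
  (measurable_one.indicator hE).comp hN.measurable

lemma lintegral_sum_cells_indicator {E : ℝ → Set (Measure ℝ)} (m : ℕ)
    (hE : ∀ u, MeasurableSet (E u)) {a b : ℝ≥0∞} (hab : ∀ u, P {ω | N ω ∈ E u} + a = b) :
    ∫⁻ ω, ∑ k ∈ Finset.range m, (E ((k : ℝ) / m)).indicator 1 (N ω) ∂P + m * a = m * b := by
  rw [lintegral_finsetSum _ fun k _ => hN.measurable_indicator (hE _)]
  have (u : ℝ) : ∫⁻ ω, (E u).indicator 1 (N ω) ∂P = P {ω | N ω ∈ E u} :=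
    lintegral_indicator_one (hN.measurable (hE u))
  simp_rw [this]
  rw [← nsmul_eq_mul, ← nsmul_eq_mul]
  conv_lhs => rw [← Finset.card_range m]
  rw [← Finset.sum_const, Finset.card_range, ← Finset.sum_add_distrib]
  simp [hab]

/-- Sums a cell inequality over the `m` cells of `(0, 1]`. Only the gap indicators need to be
measurable for the integral to split. -/
lemma mean_add_le_of_cell {W : Measure ℝ → Set ℝ} {E : ℝ → Set (Measure ℝ)} {m : ℕ} (hm : 0 < m)
    (hE : ∀ u, MeasurableSet (E u)) {a b : ℝ≥0∞} (hab : ∀ u, P {ω | N ω ∈ E u} + a = b)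
    (hcell : ∀ μ, IsSimpleConfig μ → ∀ u, ∫⁻ s in Ioc u (u + 1 / m), (W μ).indicator 1 s ∂μ +
      (E u).indicator 1 μ ≤ μ (Ioc u (u + 1 / m))) :
    ∫⁻ ω, ∫⁻ s in Ioc 0 1, (W (N ω)).indicator 1 s ∂(N ω) ∂P + m * b ≤
      intensity P N + m * a := by
  have h1 := hN.lintegral_sum_cells_indicator m hE hab
  rw [← h1, ← add_assoc, ← lintegral_add_right _ (Finset.measurable_fun_sum _ fun k _ =>
    hN.measurable_indicator (hE _)),
    intensity]
  gcongr ?_ + _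
  refine lintegral_mono_ae ?_
  filter_upwards [hN.simple] with ω hω
  have h (g : ℝ → ℝ≥0∞) := lintegral_Ioc_eq_sum_cells (N ω) g hm
  have h2 := h 1
  simp only [Pi.one_apply, setLIntegral_one] at h2
  rw [h2, h, ← Finset.sum_add_distrib]
  exact Finset.sum_le_sum fun k _ => hcell _ hω _

lemma le_mean_add_of_cell {W : Measure ℝ → Set ℝ} {E : ℝ → Set (Measure ℝ)} {m : ℕ} (hm : 0 < m)
    (hE : ∀ u, MeasurableSet (E u)) {a b : ℝ≥0∞} (hab : ∀ u, P {ω | N ω ∈ E u} + a = b)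
    (hcell : ∀ μ, IsSimpleConfig μ → ∀ u, μ (Ioc u (u + 1 / m)) ≤
      ∫⁻ s in Ioc u (u + 1 / m), (W μ).indicator 1 s ∂μ + (E u).indicator 1 μ) :
    intensity P N + m * a ≤
      ∫⁻ ω, ∫⁻ s in Ioc 0 1, (W (N ω)).indicator 1 s ∂(N ω) ∂P + m * b := by
  have h1 := hN.lintegral_sum_cells_indicator m hE hab
  rw [← h1, ← add_assoc, ← lintegral_add_right _ (Finset.measurable_fun_sum _ fun k _ =>
    hN.measurable_indicator (hE _)),
    intensity]
  gcongr ?_ + _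
  refine lintegral_mono_ae ?_
  filter_upwards [hN.simple] with ω hω
  have h (g : ℝ → ℝ≥0∞) := lintegral_Ioc_eq_sum_cells (N ω) g hm
  have h2 := h 1
  simp only [Pi.one_apply, setLIntegral_one] at h2
  rw [h2, h, ← Finset.sum_add_distrib]
  exact Finset.sum_le_sum fun k _ => hcell _ hω _

lemma followedMean_add_le {m : ℕ} (hm : 0 < m) {t : ℝ} (ht : 0 ≤ t) :
    followedMean P N t + m * hitWithin P N (t + 1 / m) ≤ intensity P N + m * hitWithin P N t := by
  have hh : (0 : ℝ) < 1 / m := by positivity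
  refine hN.mean_add_le_of_cell hm (E := fun u => gapSet u (u + 1 / m) (u + 1 / m) (u + 1 / m + t))
    (fun u => measurableSet_gapSet _ _ _ _) (fun u => ?_) fun μ hμ u => followed_add_gap_le hμ _ _ _
  have := hN.measure_gap_right (le_add_of_nonneg_right hh.le : u ≤ u + 1 / m)
    (le_add_of_nonneg_right ht)
  rwa [add_sub_cancel_left, show u + 1 / m + t - u = t + 1 / m by ring] at this

lemma precededMean_add_le {m : ℕ} (hm : 0 < m) {t : ℝ} (ht : 0 ≤ t) :
    precededMean P N t + m * hitWithin P N (t + 1 / m) ≤ intensity P N + m * hitWithin P N t := by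
  have hh : (0 : ℝ) < 1 / m := by positivity
  refine hN.mean_add_le_of_cell hm (E := fun u => gapSet u (u + 1 / m) (u - t) u)
    (fun u => measurableSet_gapSet _ _ _ _) (fun u => ?_) fun μ hμ u => preceded_add_gap_le hμ _ _ _
  have := hN.measure_gap_left (le_add_of_nonneg_right hh.le : u ≤ u + 1 / m) (sub_le_self u ht)
  rwa [sub_sub_cancel, show u + 1 / m - (u - t) = t + 1 / m by ring] at this

lemma le_followedMean_add {m : ℕ} (hm : 0 < m) {t : ℝ} (ht : 1 / m ≤ t) :
    intensity P N + m * hitWithin P N (t - 1 / m) ≤ followedMean P N t + m * hitWithin P N t := by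
  have hh : (0 : ℝ) < 1 / m := by positivity
  refine hN.le_mean_add_of_cell hm (E := fun u => gapSet u (u + 1 / m) (u + 1 / m) (u + t))
    (fun u => measurableSet_gapSet _ _ _ _) (fun u => ?_)
    fun μ hμ u => le_followed_add_gap hμ _ _ _ ht
  have := hN.measure_gap_right (le_add_of_nonneg_right hh.le : u ≤ u + 1 / m)
    (by linarith : u + 1 / m ≤ u + t)
  rwa [add_sub_cancel_left, show u + t - (u + 1 / m) = t - 1 / m by ring] at this

lemma le_precededMean_add {m : ℕ} (hm : 0 < m) {t : ℝ} (ht : 1 / m ≤ t) :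
    intensity P N + m * hitWithin P N (t - 1 / m) ≤ precededMean P N t + m * hitWithin P N t := by
  have hh : (0 : ℝ) < 1 / m := by positivity
  refine hN.le_mean_add_of_cell hm (E := fun u => gapSet u (u + 1 / m) (u + 1 / m - t) u)
    (fun u => measurableSet_gapSet _ _ _ _) (fun u => ?_)
    fun μ hμ u => le_preceded_add_gap hμ _ _ _ ht
  have := hN.measure_gap_left (le_add_of_nonneg_right hh.le : u ≤ u + 1 / m)
    (by linarith : u + 1 / m - t ≤ u)
  rwa [show u + 1 / m - (u + 1 / m - t) = t by ring, show u - (u + 1 / m - t) = t - 1 / m by ring]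
    at this

omit hN in
lemma followedMean_le (t : ℝ) : followedMean P N t ≤ intensity P N := by
  refine lintegral_mono fun ω => ?_
  rw [← setLIntegral_one]
  exact lintegral_mono fun s => indicator_le_self' (fun _ _ => zero_le_one) s

omit hN in
lemma precededMean_le (t : ℝ) : precededMean P N t ≤ intensity P N := by
  refine lintegral_mono fun ω => ?_
  rw [← setLIntegral_one]
  exact lintegral_mono fun s => indicator_le_self' (fun _ _ => zero_le_one) s

/-- Emptiness is shift-invariant, so ergodicity gives it probability 0 or 1, and probability 1 would
force intensity zero. -/
lemma measure_univ_eq_zero [IsProbabilityMeasure P] (hpos : 0 < intensity P N) : P {ω | N ω univ = 0} = 0 := by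
  have hA : MeasurableSet {μ : Measure ℝ | μ univ = 0} :=
    Measure.measurable_coe MeasurableSet.univ (measurableSet_singleton 0)
  have hA' : MeasurableSet {ω | N ω univ = 0} := hN.measurable hA
  rcases hN.ergodic {μ | μ univ = 0} hA fun t => by
    ext μ
    change shift t μ univ = 0 ↔ μ univ = 0
    rw [shift_apply t μ MeasurableSet.univ, preimage_univ] with h | h
  · rwa [Measure.map_apply hN.measurable hA] at h
  · exfalso
    rw [Measure.map_apply hN.measurable hA] at h
    have hae : ∀ᵐ ω ∂P, N ω univ = 0 := (prob_compl_eq_zero_iff hA').2 h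
    refine hpos.ne' ?_
    rw [intensity, lintegral_eq_zero_iff (hN.measurable_apply measurableSet_Ioc)]
    filter_upwards [hae] with ω hω using measure_mono_null (subset_univ _) hω

end IsStationaryErgodicSimple

lemma palm_nextPoint {ι : Type*} {M : ι → Ω → Measure ℝ} {i : ι}
    (hM : IsStationaryErgodicSimple P (M i)) (t : ℝ) :
    palm P M (M i) {μ | nextPoint (μ i) ≤ (t : EReal)} =
      followedMean P (M i) t / intensity P (M i) := by
  rw [palm, followedMean]
  congr 1
  refine lintegral_congr_ae ?_
  filter_upwards [hM.simple] with ω hω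
  refine lintegral_congr fun s => ?_
  have : (fun j => shift s (M j ω)) ∈ {μ : ι → Measure ℝ | nextPoint (μ i) ≤ (t : EReal)} ↔
    s ∈ followed t (M i ω) := hω.nextPoint_shift_le_iff s t
  by_cases h : s ∈ followed t (M i ω)
  · rw [indicator_of_mem h, indicator_of_mem (this.2 h)]; rfl
  · rw [indicator_of_notMem h, indicator_of_notMem (mt this.1 h)]

/-! ### The law of the number of requested contents -/

/-- An integrated form of `q' = D` that needs no differentiability: `D` is merely antitone, and
difference quotients with steps `1 / m` suffice. -/
lemma eq_integral_of_increment_bounds {q D : ℝ → ℝ} (hD : Antitone D) (hD0 : ∀ t, 0 ≤ D t)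
    (hq : Monotone q) (hq0 : q 0 = 0)
    (hlow : ∀ m : ℕ, 0 < m → ∀ t, 0 ≤ t → D (t + 1 / m) ≤ m * (q (t + 1 / m) - q t))
    (hupp : ∀ m : ℕ, 0 < m → ∀ t, 0 ≤ t → m * (q (t + 1 / m) - q t) ≤ D t) {T : ℝ} (hT : 0 ≤ T) :
    q T = ∫ s in (0 : ℝ)..T, D s := by
  have hint (a b : ℝ) : IntervalIntegrable D volume a b := hD.intervalIntegrable
  have hbd {a b : ℝ} (hab : a ≤ b) :
      (b - a) * D b ≤ ∫ s in a..b, D s ∧ ∫ s in a..b, D s ≤ (b - a) * D a := by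
    constructor
    · rw [← smul_eq_mul, ← intervalIntegral.integral_const]
      exact intervalIntegral.integral_mono_on hab (by simp) (hint a b) fun x hx => hD hx.2
    · rw [← smul_eq_mul, ← intervalIntegral.integral_const]
      exact intervalIntegral.integral_mono_on hab (hint a b) (by simp) fun x hx => hD hx.1
  -- On each cell the increment of `q` and the integral of `D` both lie between the endpoint values
  -- of `D` divided by `m`, so the errors telescope.
  have hgrid (m : ℕ) (hm : 0 < m) (k : ℕ) :
      |q (k / m) - ∫ s in (0 : ℝ)..(k / m), D s| ≤ (D 0 - D (k / m)) / m := by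
    have hm' : (0 : ℝ) < m := by exact_mod_cast hm
    induction k with
    | zero => simp [hq0]
    | succ k ih =>
      have hk : (0 : ℝ) ≤ k / m := by positivity
      have e : ((k + 1 : ℕ) : ℝ) / m = k / m + 1 / m := by push_cast; ring
      rw [e, ← intervalIntegral.integral_add_adjacent_intervals (hint 0 (k / m)) (hint _ _)]
      have h1 := hlow m hm _ hk
      have h2 := hupp m hm _ hk
      have h3 := hbd (le_add_of_nonneg_right (one_div_pos.2 hm').le : (k : ℝ) / m ≤ k / m + 1 / m)
      rw [add_sub_cancel_left] at h3
      rw [mul_comm, ← div_le_iff₀ hm'] at h1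
      rw [mul_comm, ← le_div_iff₀ hm'] at h2
      rw [abs_le] at ih ⊢
      have e1 (x : ℝ) : 1 / (m : ℝ) * x = x / m := by ring
      rw [e1, e1] at h3
      rw [sub_div] at ih ⊢
      constructor <;> linarith
  have hfinal (m : ℕ) (hm : 0 < m) : |q T - ∫ s in (0 : ℝ)..T, D s| ≤ 2 * D 0 / m := by
    have hm' : (0 : ℝ) < m := by exact_mod_cast hm
    set k := ⌊T * m⌋₊
    have hk1 : (k : ℝ) / m ≤ T := by
      rw [div_le_iff₀ hm']; exact Nat.floor_le (by positivity)
    have hk2 : T ≤ ((k + 1 : ℕ) : ℝ) / m := by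
      rw [le_div_iff₀ hm']; push_cast; exact (Nat.lt_floor_add_one _).le
    have e : ((k + 1 : ℕ) : ℝ) / m = k / m + 1 / m := by push_cast; ring
    have a1 := (abs_le.1 (hgrid m hm k)).1
    have a2 := (abs_le.1 (hgrid m hm (k + 1))).2
    have b1 := hbd hk1
    have b2 := hbd hk2
    have i1 := intervalIntegral.integral_add_adjacent_intervals (hint 0 (k / m)) (hint (k / m) T)
    have i2 := intervalIntegral.integral_add_adjacent_intervals (hint 0 T)
      (hint T (((k + 1 : ℕ) : ℝ) / m))
    have q1 := hq hk1
    have q2 := hq hk2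
    have hk0 : (0 : ℝ) ≤ k / m := by positivity
    have c1 : (T - k / m) * D (k / m) ≤ 1 / m * D 0 :=
      mul_le_mul (by linarith) (hD hk0) (hD0 _) (by positivity)
    have c2 : (((k + 1 : ℕ) : ℝ) / m - T) * D T ≤ 1 / m * D 0 :=
      mul_le_mul (by linarith) (hD hT) (hD0 _) (by positivity)
    have d1 : (D 0 - D (k / m)) / m ≤ D 0 / m := by
      gcongr; linarith [hD0 (k / m)]
    have d2 : (D 0 - D (((k + 1 : ℕ) : ℝ) / m)) / m ≤ D 0 / m := by
      gcongr; linarith [hD0 (((k + 1 : ℕ) : ℝ) / m)]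
    have e1 : 1 / (m : ℝ) * D 0 = D 0 / m := by ring
    have e2 : 2 * D 0 / (m : ℝ) = D 0 / m + D 0 / m := by ring
    rw [abs_le]
    constructor <;> linarith
  have hlim : Tendsto (fun m : ℕ => 2 * D 0 / (m : ℝ)) atTop (𝓝 0) :=
    tendsto_const_div_atTop_nhds_zero_nat _
  have := ge_of_tendsto hlim (eventually_atTop.2 ⟨1, fun m hm => hfinal m hm⟩)
  linarith [abs_nonpos_iff.1 this]

variable {Ω : Type*} [MeasurableSpace Ω] {P : Measure Ω} {N : Ω → Measure ℝ}

lemma hitWithin_mono {s t : ℝ} (hst : s ≤ t) : hitWithin P N s ≤ hitWithin P N t :=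
  measure_mono fun _ hω h => hω (measure_mono_null (Ioc_subset_Ioc_right hst) h)

/-- The stationary excess distribution function of `ψ` when the mean of `ψ` is one. -/
noncomputable def excessCdf (ψ : Measure ℝ) (t : ℝ) : ℝ := ∫ z in (0 : ℝ)..t, (1 - cdf ψ z)

namespace IsStationaryErgodicSimple

variable [IsProbabilityMeasure P] (hN : IsStationaryErgodicSimple P N) (hpos : 0 < intensity P N)
  (hlt : intensity P N < ⊤) {ψ : Measure ℝ}
  (hψ : ∀ t, (followedMean P N (t / (intensity P N).toReal) / intensity P N).toReal = cdf ψ t)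
include hN hpos hlt hψ

omit hN [IsProbabilityMeasure P] in
lemma toReal_followedMean (t : ℝ) : (followedMean P N t).toReal =
    (intensity P N).toReal * cdf ψ ((intensity P N).toReal * t) := by
  have h0 := ENNReal.toReal_pos hpos.ne' hlt.ne
  rw [← hψ, mul_div_cancel_left₀ _ h0.ne', ENNReal.toReal_div, mul_div_cancel₀ _ h0.ne']

/-- The Palm–Khinchin relation: the hitting probability grows at rate `l * (1 - cdf ψ (l * t))`, the
intensity of points with no successor within `t`. -/
lemma toReal_hitWithin {t : ℝ} (ht : 0 ≤ t) :
    (hitWithin P N t).toReal = excessCdf ψ ((intensity P N).toReal * t) := by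
  set l := (intensity P N).toReal
  have h0 : 0 < l := ENNReal.toReal_pos hpos.ne' hlt.ne
  have hq (t : ℝ) : hitWithin P N t ≠ ⊤ := measure_ne_top _ _
  have hF (t : ℝ) : followedMean P N t ≠ ⊤ := ((followedMean_le t).trans_lt hlt).ne
  have key := eq_integral_of_increment_bounds (q := fun t => (hitWithin P N t).toReal)
    (D := fun t => l * (1 - cdf ψ (l * t))) ?_ ?_ ?_ ?_ ?_ ?_ ht
  · rw [key, excessCdf, intervalIntegral.integral_const_mul]
    have := intervalIntegral.mul_integral_comp_mul_left (a := 0) (b := t)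
      (f := fun z => 1 - cdf ψ z) (c := l)
    rw [mul_zero] at this
    exact this
  · intro s t hst
    have := monotone_cdf ψ (mul_le_mul_of_nonneg_left hst h0.le)
    exact mul_le_mul_of_nonneg_left (by linarith) h0.le
  · intro t
    have := cdf_le_one ψ (l * t)
    exact mul_nonneg h0.le (by linarith)
  · intro s t hst
    exact ENNReal.toReal_mono (hq t) (hitWithin_mono hst)
  · simp [hitWithin]
  · intro m hm t ht
    have hm' : (0 : ℝ) < m := by exact_mod_cast hm
    have h := ENNReal.toReal_mono (by finiteness [hF (t + 1 / m), hq (t + 1 / m)])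
      (hN.le_followedMean_add hm (le_add_of_nonneg_left ht : 1 / (m : ℝ) ≤ t + 1 / m))
    rw [add_sub_cancel_right, ENNReal.toReal_add hlt.ne (by finiteness [hq t]),
      ENNReal.toReal_add (hF _) (by finiteness [hq (t + 1 / m)]), ENNReal.toReal_mul,
      ENNReal.toReal_mul, toReal_followedMean hpos hlt hψ, ENNReal.toReal_natCast] at h
    linarith
  · intro m hm t ht
    have h := ENNReal.toReal_mono (by finiteness [hq t, hlt.ne]) (hN.followedMean_add_le hm ht)
    rw [ENNReal.toReal_add hlt.ne (by finiteness [hq t]),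
      ENNReal.toReal_add (hF _) (by finiteness [hq (t + 1 / m)]), ENNReal.toReal_mul,
      ENNReal.toReal_mul, toReal_followedMean hpos hlt hψ, ENNReal.toReal_natCast] at h
    linarith

/-- Time reversal. Forward and backward counts are controlled by the same increments of `hitWithin`,
so `precededMean` at `t` lies between the forward quantities at `t - 1 / m` and `t + 1 / m`;
continuity of the cdf closes the gap. -/
lemma toReal_precededMean (hψcont : Continuous (cdf ψ)) {t : ℝ} (ht : 0 < t) :
    (precededMean P N t).toReal =
      (intensity P N).toReal * cdf ψ ((intensity P N).toReal * t) := by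
  set l := (intensity P N).toReal with hl
  have hq (t : ℝ) : hitWithin P N t ≠ ⊤ := measure_ne_top _ _
  have hF (t : ℝ) : followedMean P N t ≠ ⊤ := ((followedMean_le t).trans_lt hlt).ne
  have hB (t : ℝ) : precededMean P N t ≠ ⊤ := ((precededMean_le t).trans_lt hlt).ne
  have hinv : Tendsto (fun m : ℕ => 1 / (m : ℝ)) atTop (𝓝 0) := tendsto_one_div_atTop_nhds_zero_nat
  have hc : Continuous fun t => l * cdf ψ (l * t) := by fun_prop
  have hR1 (m : ℕ) (hm : 0 < m) (t : ℝ) (ht : 0 ≤ t) :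
      (precededMean P N t).toReal + m * (hitWithin P N (t + 1 / m)).toReal ≤
        l + m * (hitWithin P N t).toReal := by
    have h := ENNReal.toReal_mono (by finiteness [hq t, hlt.ne]) (hN.precededMean_add_le hm ht)
    rwa [ENNReal.toReal_add hlt.ne (by finiteness [hq t]),
      ENNReal.toReal_add (hB _) (by finiteness [hq (t + 1 / m)]), ENNReal.toReal_mul,
      ENNReal.toReal_mul, ENNReal.toReal_natCast] at h
  have hR2 (m : ℕ) (hm : 0 < m) (t : ℝ) (ht : 1 / m ≤ t) :
      l + m * (hitWithin P N (t - 1 / m)).toReal ≤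
        (precededMean P N t).toReal + m * (hitWithin P N t).toReal := by
    have h := ENNReal.toReal_mono (by finiteness [hB t, hq t]) (hN.le_precededMean_add hm ht)
    rwa [ENNReal.toReal_add hlt.ne (by finiteness [hq (t - 1 / m)]),
      ENNReal.toReal_add (hB _) (by finiteness [hq t]), ENNReal.toReal_mul,
      ENNReal.toReal_mul, ENNReal.toReal_natCast] at h
  have hF1 (m : ℕ) (hm : 0 < m) (t : ℝ) (ht : 0 ≤ t) :
      l * cdf ψ (l * t) + m * (hitWithin P N (t + 1 / m)).toReal ≤
        l + m * (hitWithin P N t).toReal := by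
    have h := ENNReal.toReal_mono (by finiteness [hq t, hlt.ne]) (hN.followedMean_add_le hm ht)
    rwa [ENNReal.toReal_add hlt.ne (by finiteness [hq t]),
      ENNReal.toReal_add (hF _) (by finiteness [hq (t + 1 / m)]), ENNReal.toReal_mul,
      ENNReal.toReal_mul, ENNReal.toReal_natCast, toReal_followedMean hpos hlt hψ] at h
  have hF2 (m : ℕ) (hm : 0 < m) (t : ℝ) (ht : 1 / m ≤ t) :
      l + m * (hitWithin P N (t - 1 / m)).toReal ≤
        l * cdf ψ (l * t) + m * (hitWithin P N t).toReal := by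
    have h := ENNReal.toReal_mono (by finiteness [hF t, hq t]) (hN.le_followedMean_add hm ht)
    rwa [ENNReal.toReal_add hlt.ne (by finiteness [hq (t - 1 / m)]),
      ENNReal.toReal_add (hF _) (by finiteness [hq t]), ENNReal.toReal_mul,
      ENNReal.toReal_mul, ENNReal.toReal_natCast, toReal_followedMean hpos hlt hψ] at h
  refine le_antisymm ?_ ?_
  · have hlim := (hc.tendsto (t + 0)).comp (tendsto_const_nhds.add hinv)
    rw [add_zero] at hlim
    refine ge_of_tendsto hlim (eventually_atTop.2 ⟨1, fun m hm => ?_⟩)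
    have h1 := hR1 m hm t ht.le
    have h2 := hF2 m hm (t + 1 / m) (by linarith)
    rw [add_sub_cancel_right] at h2
    simp only [Function.comp]
    linarith
  · have hlim := (hc.tendsto (t - 0)).comp (tendsto_const_nhds.sub hinv)
    rw [sub_zero] at hlim
    refine le_of_tendsto hlim ?_
    filter_upwards [hinv.eventually_lt_const ht, eventually_ge_atTop 1] with m hmt hm
    have h1 := hR2 m hm t hmt.le
    have h2 := hF1 m hm (t - 1 / m) (by linarith)
    rw [sub_add_cancel] at h2
    simp only [Function.comp]
    linarith

omit hlt hψ in
-- The windows `(-k, k]` exhaust the line and almost surely some point exists. Through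
-- `toReal_hitWithin` this makes `excessCdf ψ` tend to `1`, which is what fixes the mean of `ψ`.
lemma tendsto_hitWithin_atTop :
    Tendsto (fun k : ℕ => (hitWithin P N (2 * k)).toReal) atTop (𝓝 1) := by
  have h1 : Tendsto (fun k : ℕ => P {ω | N ω (Ioc (-k : ℝ) k) ≠ 0}) atTop
      (𝓝 (P (⋃ k : ℕ, {ω | N ω (Ioc (-k : ℝ) k) ≠ 0}))) := by
    refine tendsto_measure_iUnion_atTop fun j k hjk ω hω h => hω (measure_mono_null ?_ h)
    have : (j : ℝ) ≤ k := by exact_mod_cast hjk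
    exact Ioc_subset_Ioc (by linarith) this
  have h2 : P (⋃ k : ℕ, {ω | N ω (Ioc (-k : ℝ) k) ≠ 0}) = 1 := by
    rw [← prob_compl_eq_zero_iff (.iUnion fun k => hN.measurableSet_ne_zero measurableSet_Ioc)]
    refine measure_mono_null (fun ω hω => ?_) (hN.measure_univ_eq_zero hpos)
    rw [compl_iUnion, mem_iInter] at hω
    have hU : (⋃ k : ℕ, Ioc (-k : ℝ) k) = univ := by
      refine eq_univ_of_forall fun x => mem_iUnion.2 ?_
      obtain ⟨k, hk⟩ := exists_nat_gt |x|
      exact ⟨k, (abs_lt.1 hk).1, (abs_lt.1 hk).2.le⟩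
    change N ω univ = 0
    rw [← hU]
    exact measure_iUnion_null fun k => not_not.1 (hω k)
  rw [h2] at h1
  have h3 := (ENNReal.tendsto_toReal ENNReal.one_ne_top).comp h1
  refine h3.congr fun k => ?_
  simp only [Function.comp, hN.measure_Ioc_ne_zero]
  congr 2
  ring

end IsStationaryErgodicSimple

/-! ### The stationary excess distribution -/

section ExcessCdf

variable {ψ : Measure ℝ}

lemma intervalIntegrable_one_sub_cdf (a b : ℝ) :
    IntervalIntegrable (fun z => 1 - cdf ψ z) volume a b :=
  Antitone.intervalIntegrable fun _ _ hst => by linarith [monotone_cdf ψ hst]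

lemma excessCdf_zero : excessCdf ψ 0 = 0 := intervalIntegral.integral_same

lemma continuous_excessCdf : Continuous (excessCdf ψ) :=
  intervalIntegral.continuous_primitive intervalIntegrable_one_sub_cdf 0

lemma excessCdf_sub (s t : ℝ) : excessCdf ψ t - excessCdf ψ s = ∫ z in s..t, (1 - cdf ψ z) :=
  intervalIntegral.integral_interval_sub_left (intervalIntegrable_one_sub_cdf 0 t)
    (intervalIntegrable_one_sub_cdf 0 s)

lemma mul_one_sub_cdf_le_excessCdf_sub {s t : ℝ} (hst : s ≤ t) :
    (t - s) * (1 - cdf ψ t) ≤ excessCdf ψ t - excessCdf ψ s := by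
  rw [excessCdf_sub, ← smul_eq_mul, ← intervalIntegral.integral_const]
  refine intervalIntegral.integral_mono_on hst (by simp) (intervalIntegrable_one_sub_cdf s t)
    fun x hx => ?_
  linarith [monotone_cdf ψ hx.2]

lemma excessCdf_sub_le {s t : ℝ} (hst : s ≤ t) :
    excessCdf ψ t - excessCdf ψ s ≤ (t - s) * (1 - cdf ψ s) := by
  rw [excessCdf_sub, ← smul_eq_mul, ← intervalIntegral.integral_const]
  refine intervalIntegral.integral_mono_on hst (intervalIntegrable_one_sub_cdf s t) (by simp)
    fun x hx => ?_
  linarith [monotone_cdf ψ hx.1]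

lemma monotone_excessCdf : Monotone (excessCdf ψ) := fun s t hst => by
  have h1 := mul_one_sub_cdf_le_excessCdf_sub (ψ := ψ) hst
  have h2 := mul_nonneg (sub_nonneg.2 hst) (sub_nonneg.2 (cdf_le_one ψ t))
  linarith

lemma excessCdf_nonneg {t : ℝ} (ht : 0 ≤ t) : 0 ≤ excessCdf ψ t :=
  excessCdf_zero.symm.le.trans (monotone_excessCdf ht)

variable {b : ℕ → ℝ} (hb : Tendsto b atTop atTop)
  (hlim : Tendsto (fun k => excessCdf ψ (b k)) atTop (𝓝 1))
include hb hlim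

lemma tendsto_excessCdf : Tendsto (excessCdf ψ) atTop (𝓝 1) :=
  (tendsto_iff_tendsto_subseq_of_monotone monotone_excessCdf hb).2 hlim

/-- Layer-cake formula: the mean is the integral of the tail `1 - cdf ψ`, that is, the limit of
`excessCdf ψ`. -/
lemma integral_id_eq_one [IsProbabilityMeasure ψ] (hψsupp : ∀ t < 0, cdf ψ t = 0) :
    ∫ x, x ∂ψ = 1 := by
  have hnn : 0 ≤ᵐ[ψ] fun x => x := by
    have h0 : ψ (Iio 0) = 0 := by
      have : Iio (0 : ℝ) = ⋃ k : ℕ, Iic (-(1 / ((k : ℝ) + 1))) := by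
        ext x
        simp only [mem_Iio, mem_iUnion, mem_Iic]
        constructor
        · intro hx
          obtain ⟨k, hk⟩ := exists_nat_one_div_lt (neg_pos.2 hx)
          exact ⟨k, by linarith⟩
        · rintro ⟨k, hk⟩
          have : (0 : ℝ) < 1 / ((k : ℝ) + 1) := by positivity
          linarith
      rw [this]
      refine measure_iUnion_null fun k => ?_
      have hk : (0 : ℝ) < 1 / ((k : ℝ) + 1) := by positivity
      rw [← ofReal_cdf, hψsupp _ (by linarith), ENNReal.ofReal_zero]
    rw [EventuallyLE, ae_iff]
    simpa [Iio] using h0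
  have hnn' (t : ℝ) : 0 ≤ 1 - cdf ψ t := sub_nonneg.2 (cdf_le_one ψ t)
  have hIoi : IntegrableOn (fun z => 1 - cdf ψ z) (Ioi 0) :=
    integrableOn_Ioi_of_intervalIntegral_norm_tendsto 1 0
      (fun k => (intervalIntegrable_one_sub_cdf (ψ := ψ) 0 (b k)).1) hb
      (by simp only [Real.norm_of_nonneg (hnn' _)]; exact hlim)
  have hval : ∫ z in Ioi 0, (1 - cdf ψ z) = 1 :=
    tendsto_nhds_unique (intervalIntegral_tendsto_integral_Ioi 0 hIoi hb) hlim
  rw [integral_eq_lintegral_of_nonneg_ae hnn aestronglyMeasurable_id,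
    lintegral_eq_lintegral_meas_lt ψ hnn aemeasurable_id]
  have (t : ℝ) : ψ {a | t < a} = ENNReal.ofReal (1 - cdf ψ t) := by
    have : {a : ℝ | t < a} = (Iic t)ᶜ := by ext; simp
    rw [this, prob_compl_eq_one_sub measurableSet_Iic, ← ofReal_cdf,
      ENNReal.ofReal_sub _ (cdf_nonneg ψ t), ENNReal.ofReal_one]
  simp_rw [this]
  rw [← integral_eq_lintegral_of_nonneg_ae (.of_forall hnn') hIoi.aestronglyMeasurable, hval]

lemma excessCdf_le_one (t : ℝ) : excessCdf ψ t ≤ 1 :=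
  monotone_excessCdf.ge_of_tendsto (tendsto_excessCdf hb hlim) t

/-- A flat stretch forces `cdf ψ t = 1`, after which `excessCdf ψ` never increases, so it has
already reached its limit `1`. -/
lemma excessCdf_eq_one_of_eq {s t : ℝ} (hst : s < t) (h : excessCdf ψ s = excessCdf ψ t) :
    excessCdf ψ s = 1 := by
  have h1 := mul_one_sub_cdf_le_excessCdf_sub (ψ := ψ) hst.le
  have h2 : 1 - cdf ψ t ≤ 0 := by
    rw [h, sub_self] at h1
    by_contra! h3
    linarith [mul_pos (sub_pos.2 hst) h3]
  refine tendsto_nhds_unique (f := fun _ : ℝ => excessCdf ψ s) (l := atTop) tendsto_const_nhds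
    ((tendsto_excessCdf hb hlim).congr' ?_)
  filter_upwards [eventually_ge_atTop t] with u hu
  have h3 := excessCdf_sub_le (ψ := ψ) hu
  have h4 := mul_nonpos_of_nonneg_of_nonpos (sub_nonneg.2 hu) h2
  have h5 := monotone_excessCdf (ψ := ψ) hu
  linarith

end ExcessCdf

/-! ### The limiting characteristic time -/

section CharacteristicTime

variable {m : Measure ℝ} [IsProbabilityMeasure m] {f : ℝ → ℝ} (hf : AEStronglyMeasurable f m)
  (hf0 : ∀ᵐ x ∂m, 0 < f x) {E : ℝ → ℝ} (hE : Continuous E) (hE0 : E 0 = 0)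
  (hEmono : Monotone E) (hE1 : ∀ t, E t ≤ 1) (hElim : Tendsto E atTop (𝓝 1))
  (hEeq : ∀ s t, s < t → E s = E t → E s = 1)
include hf hf0 hE hE0 hEmono hE1

omit hf0 hE0 hEmono hE1 [IsProbabilityMeasure m] in
lemma aestronglyMeasurable_comp_mul (ν : ℝ) : AEStronglyMeasurable (fun x => E (ν * f x)) m :=
  hE.comp_aestronglyMeasurable (hf.const_mul ν)

omit hf hE [IsProbabilityMeasure m] in
lemma norm_comp_mul_le {ν : ℝ} (hν : 0 ≤ ν) : ∀ᵐ x ∂m, ‖E (ν * f x)‖ ≤ 1 := by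
  filter_upwards [hf0] with x hx
  have : 0 ≤ E (ν * f x) := hE0.symm.le.trans (hEmono (by positivity))
  rw [Real.norm_of_nonneg this]
  exact hE1 _

lemma integrable_comp_mul {ν : ℝ} (hν : 0 ≤ ν) : Integrable (fun x => E (ν * f x)) m :=
  .of_bound (aestronglyMeasurable_comp_mul hf hE ν) 1 (norm_comp_mul_le hf0 hE0 hEmono hE1 hν)

include hEeq in
lemma integral_comp_mul_lt {ν ν' : ℝ} (hν : 0 ≤ ν) (hνν' : ν < ν')
    (h1 : ∫ x, E (ν * f x) ∂m ≠ 1) : ∫ x, E (ν * f x) ∂m < ∫ x, E (ν' * f x) ∂m := by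
  have hi := integrable_comp_mul hf hf0 hE hE0 hEmono hE1 hν
  have hi' := integrable_comp_mul hf hf0 hE hE0 hEmono hE1 (hν.trans hνν'.le)
  have hle : (fun x => E (ν * f x)) ≤ᵐ[m] fun x => E (ν' * f x) := by
    filter_upwards [hf0] with x hx
    exact hEmono (by gcongr)
  refine lt_of_le_of_ne (integral_mono_ae hi hi' hle) fun h => h1 ?_
  rw [integral_eq_iff_of_ae_le hi hi' hle] at h
  have : (fun x => E (ν * f x)) =ᵐ[m] fun _ => 1 := by
    filter_upwards [h, hf0] with x hx hx0
    exact hEeq _ _ (by gcongr) hx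
  rw [integral_congr_ae this]
  simp

include hElim hEeq in
-- The integral is continuous in `ν`, runs from `0` to `1`, and increases strictly while below `1`.
-- The strict inequalities on both sides give uniqueness and also the room needed for concentration.
lemma exists_characteristic_time {β : ℝ} (hβ : β ∈ Ioo (0 : ℝ) 1) :
    ∃ ν₀, 0 < ν₀ ∧ ∫ x, E (ν₀ * f x) ∂m = β ∧
      (∀ ν, 0 ≤ ν → ν < ν₀ → ∫ x, E (ν * f x) ∂m < β) ∧
      ∀ ν, ν₀ < ν → β < ∫ x, E (ν * f x) ∂m := by
  have hcont : ContinuousOn (fun ν => ∫ x, E (ν * f x) ∂m) (Ici 0) := by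
    refine continuousOn_of_dominated (bound := fun _ => 1)
      (fun ν _ => aestronglyMeasurable_comp_mul hf hE ν)
      (fun ν hν => norm_comp_mul_le hf0 hE0 hEmono hE1 hν) (integrable_const _)
      (.of_forall fun x => ?_)
    exact (hE.comp (continuous_mul_const (f x))).continuousOn
  have hlim : Tendsto (fun ν => ∫ x, E (ν * f x) ∂m) atTop (𝓝 1) := by
    have : ∫ _, (1 : ℝ) ∂m = 1 := by simp
    rw [← this]
    refine tendsto_integral_filter_of_dominated_convergence (fun _ => 1)
      (.of_forall fun ν => aestronglyMeasurable_comp_mul hf hE ν) ?_ (integrable_const _) ?_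
    · filter_upwards [eventually_ge_atTop 0] with ν hν
      exact norm_comp_mul_le hf0 hE0 hEmono hE1 hν
    · filter_upwards [hf0] with x hx
      exact hElim.comp (tendsto_id.atTop_mul_const hx)
  obtain ⟨K, hK, hK0⟩ := ((hlim.eventually_const_lt hβ.2).and (eventually_ge_atTop 0)).exists
  obtain ⟨ν₀, hν₀, h⟩ := intermediate_value_Ioo hK0 (hcont.mono Icc_subset_Ici_self)
    (show β ∈ Ioo _ _ from ⟨by simpa [hE0] using hβ.1, hK⟩)
  beta_reduce at h
  refine ⟨ν₀, hν₀.1, h, fun ν hν hlt => ?_, fun ν hlt => ?_⟩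
  · by_cases h1 : ∫ x, E (ν * f x) ∂m = 1
    · have hle : ∫ x, E (ν * f x) ∂m ≤ ∫ x, E (ν₀ * f x) ∂m := by
        refine integral_mono_ae (integrable_comp_mul hf hf0 hE hE0 hEmono hE1 hν)
          (integrable_comp_mul hf hf0 hE hE0 hEmono hE1 hν₀.1.le) ?_
        filter_upwards [hf0] with x hx
        exact hEmono (by gcongr)
      linarith [hβ.2]
    · rw [← h]
      exact integral_comp_mul_lt hf hf0 hE hE0 hEmono hE1 hEeq hν hlt h1
  · nth_rewrite 1 [← h]
    exact integral_comp_mul_lt hf hf0 hE hE0 hEmono hE1 hEeq hν₀.1.le hlt (by linarith [hβ.2])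

end CharacteristicTime

/-! ### Riemann sums along step functions -/

/-- The step function on `[0, 1)` with value `a i` on `[i / n, (i + 1) / n)`. -/
noncomputable def stepFun {n : ℕ} (a : Fin n → ℝ) (x : ℝ) : ℝ :=
  if h : ⌊(n : ℝ) * x⌋₊ < n then a ⟨_, h⟩ else 0

lemma measurable_stepFun {n : ℕ} (a : Fin n → ℝ) : Measurable (stepFun a) :=
  (measurable_from_nat (f := fun k => if h : k < n then a ⟨k, h⟩ else 0)).comp
    (Nat.measurable_floor.comp (measurable_id.const_mul (n : ℝ)))

lemma stepFun_nonneg {n : ℕ} {a : Fin n → ℝ} (ha : ∀ i, 0 ≤ a i) (x : ℝ) : 0 ≤ stepFun a x := by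
  rw [stepFun]
  split_ifs
  exacts [ha _, le_rfl]

lemma stepFun_eq {n : ℕ} (a : Fin n → ℝ) (k : Fin n) {x : ℝ}
    (hx : x ∈ Ioo ((k : ℝ) / n) (((k : ℝ) + 1) / n)) : stepFun a x = a k := by
  have hn : (0 : ℝ) < n := by exact_mod_cast k.pos
  have hk : ⌊(n : ℝ) * x⌋₊ = k := by
    have h1 := hx.1.le
    have h2 := hx.2
    rw [div_le_iff₀ hn] at h1
    rw [lt_div_iff₀ hn] at h2
    have h0 : (0 : ℝ) ≤ n * x := by
      have : (0 : ℝ) ≤ (k : ℝ) := by positivity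
      linarith
    rw [Nat.floor_eq_iff h0]
    constructor <;> linarith
  rw [stepFun, dif_pos (hk ▸ k.isLt)]
  congr 1
  exact Fin.ext hk

lemma integral_comp_stepFun {n : ℕ} (hn : 0 < n) (a : Fin n → ℝ) (g : ℝ → ℝ) :
    IntervalIntegrable (fun x => g (stepFun a x)) volume 0 1 ∧
      ∫ x in (0 : ℝ)..1, g (stepFun a x) = (n : ℝ)⁻¹ * ∑ i, g (a i) := by
  have hn' : (0 : ℝ) < n := by exact_mod_cast hn
  have heq (k : ℕ) (hk : k < n) : EqOn (fun x => g (stepFun a x)) (fun _ => g (a ⟨k, hk⟩))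
      (uIoo ((k : ℝ) / n) (((k + 1 : ℕ) : ℝ) / n)) := by
    rw [uIoo_of_le (by gcongr; simp)]
    intro x hx
    beta_reduce
    rw [stepFun_eq a ⟨k, hk⟩ (by simpa using hx)]
  have hint (k : ℕ) (hk : k < n) : IntervalIntegrable (fun x => g (stepFun a x)) volume
      ((k : ℝ) / n) (((k + 1 : ℕ) : ℝ) / n) :=
    (intervalIntegrable_const (c := g (a ⟨k, hk⟩))).congr_uIoo (heq k hk).symm
  have h1 := IntervalIntegrable.trans_iterate hint
  have h2 := intervalIntegral.sum_integral_adjacent_intervals hint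
  rw [Nat.cast_zero, zero_div, div_self hn'.ne'] at h1 h2
  refine ⟨h1, ?_⟩
  rw [← h2, Finset.sum_range, Finset.mul_sum]
  refine Finset.sum_congr rfl fun k _ => ?_
  rw [intervalIntegral.integral_congr_uIoo (heq k k.isLt), intervalIntegral.integral_const]
  push_cast
  rw [smul_eq_mul]
  congr 1
  field_simp
  ring

/-- On the cell containing `x`, `n * p n i` equals `f (z n i)` divided by a ratio tending to `1`,
and `z n i` is within `1 / n` of `x`. -/
lemma tendsto_stepFun_of_fagin {p : ∀ n : ℕ, Fin n → ℝ} (hp : ∀ n i, 0 < p n i) {f : ℝ → ℝ}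
    (hf : FaginCondition p (fun n => (n : ℝ)⁻¹) f) {x : ℝ} (hx : x ∈ Ioo (0 : ℝ) 1) :
    Tendsto (fun n => stepFun (fun i => n * p n i) x) atTop (𝓝 (f x)) := by
  obtain ⟨hcont, -, -, z, hz, hlim⟩ := hf
  have hfx : ContinuousAt f x := hcont.continuousAt (Ioc_mem_nhds hx.1 hx.2)
  have hfl (n : ℕ) (hn : 0 < n) : ⌊(n : ℝ) * x⌋₊ < n := by
    have hn' : (0 : ℝ) < n := by exact_mod_cast hn
    rw [Nat.floor_lt (mul_nonneg hn'.le hx.1.le)]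
    nlinarith [hx.2]
  set y : ℕ → ℝ := fun n => if h : ⌊(n : ℝ) * x⌋₊ < n then z n ⟨_, h⟩ else 0
  have hy : Tendsto y atTop (𝓝 x) := by
    have hinv : Tendsto (fun m : ℕ => 1 / (m : ℝ)) atTop (𝓝 0) :=
      tendsto_one_div_atTop_nhds_zero_nat
    have hdiff (n : ℕ) (hn : 0 < n) : |y n - x| ≤ 1 / n := by
      have hn' : (0 : ℝ) < n := by exact_mod_cast hn
      have h1 := hz n ⟨_, hfl n hn⟩
      have h2 := Nat.floor_le (mul_nonneg hn'.le hx.1.le)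
      have h3 := Nat.lt_floor_add_one ((n : ℝ) * x)
      have h4 : (⌊(n : ℝ) * x⌋₊ : ℝ) / n ≤ x := by rw [div_le_iff₀ hn']; linarith
      have h5 : x ≤ ((⌊(n : ℝ) * x⌋₊ : ℝ) + 1) / n := by rw [le_div_iff₀ hn']; linarith
      simp only [y, dif_pos (hfl n hn)]
      have h6 := h1.1
      have h7 := h1.2
      simp only [add_div] at h5 h6 h7
      rw [abs_le]
      constructor <;> linarith
    rw [tendsto_iff_dist_tendsto_zero]
    refine squeeze_zero' (.of_forall fun _ => dist_nonneg) ?_ hinv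
    filter_upwards [eventually_gt_atTop 0] with n hn
    exact hdiff n hn
  have hfy := hfx.tendsto.comp hy
  set r : ℕ → ℝ := fun n =>
    if h : ⌊(n : ℝ) * x⌋₊ < n then (n : ℝ)⁻¹ * f (z n ⟨_, h⟩) / p n ⟨_, h⟩ else 0
  have hr : Tendsto r atTop (𝓝 1) := by
    rw [Metric.tendsto_atTop]
    intro ε hε
    obtain ⟨n₀, hn₀⟩ := eventually_atTop.1 (hlim ε hε)
    refine ⟨max n₀ 1, fun n hn => ?_⟩
    simp only [r, dif_pos (hfl n (le_of_max_le_right hn)), Real.dist_eq]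
    exact hn₀ n (le_of_max_le_left hn) _
  have hdiv := hfy.div hr one_ne_zero
  rw [div_one] at hdiv
  refine hdiv.congr' ?_
  filter_upwards [eventually_gt_atTop 0, hr.eventually_ne one_ne_zero] with n hn hrn
  have hn' : (n : ℝ) ≠ 0 := by exact_mod_cast hn.ne'
  simp only [Pi.div_apply, Function.comp, y, r, stepFun, dif_pos (hfl n hn)] at hrn ⊢
  have h1 := (hp n ⟨_, hfl n hn⟩).ne'
  have h2 : f (z n ⟨_, hfl n hn⟩) ≠ 0 := fun h0 => hrn (by simp [h0])
  field_simp

section RiemannSums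

variable {p : ∀ n : ℕ, Fin n → ℝ} (hp : ∀ n i, 0 < p n i) {f : ℝ → ℝ}
  (hf : FaginCondition p (fun n => (n : ℝ)⁻¹) f) {φ : ℝ → ℝ} (hφ : Continuous φ)
  (hφ1 : ∀ t, 0 ≤ t → |φ t| ≤ 1)
include hp hf hφ hφ1

omit hφ hφ1 in
lemma ae_tendsto_stepFun : ∀ᵐ x ∂(volume.restrict (Ioc (0 : ℝ) 1)),
    Tendsto (fun n => stepFun (fun i => n * p n i) x) atTop (𝓝 (f x)) := by
  rw [← restrict_Ioo_eq_restrict_Ioc]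
  filter_upwards [ae_restrict_mem measurableSet_Ioo] with x hx
  exact tendsto_stepFun_of_fagin hp hf hx

lemma tendsto_average_of_fagin :
    Tendsto (fun n : ℕ => (n : ℝ)⁻¹ * ∑ i, φ (n * p n i)) atTop
      (𝓝 (∫ x in (0 : ℝ)..1, φ (f x))) := by
  have h : Tendsto (fun n : ℕ => ∫ x in (0 : ℝ)..1, φ (stepFun (fun i => n * p n i) x)) atTop
      (𝓝 (∫ x in (0 : ℝ)..1, φ (f x))) := by
    simp only [intervalIntegral.integral_of_le zero_le_one]
    refine tendsto_integral_of_dominated_convergence (fun _ => 1)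
      (fun n => (hφ.measurable.comp (measurable_stepFun _)).aestronglyMeasurable)
      (integrable_const _) (fun n => .of_forall fun x => hφ1 _ (stepFun_nonneg (fun i => ?_) x)) ?_
    · have := hp n i
      positivity
    · filter_upwards [ae_tendsto_stepFun hp hf] with x hx
      exact (hφ.tendsto _).comp hx
  refine h.congr' ?_
  filter_upwards [eventually_gt_atTop 0] with n hn
  exact (integral_comp_stepFun hn _ _).2

/-- A Scheffé argument, as `f` may be unbounded. The step functions `g n` and `f` all have integral
`1`; `min (g n) f` is dominated by `f`, so the excess `g n - min (g n) f` has integral tending to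
`0`. -/
lemma tendsto_weighted_sum_of_fagin (hf_one : ∫ x in (0 : ℝ)..1, f x = 1)
    (hp_one : ∀ n, 0 < n → ∑ i, p n i = 1) :
    Tendsto (fun n : ℕ => ∑ i, p n i * φ (n * p n i)) atTop
      (𝓝 (∫ x in (0 : ℝ)..1, f x * φ (f x))) := by
  -- A non-integrable function has integral `0` by convention, so integral `1` already implies
  -- integrability.
  have hfint : Integrable f (volume.restrict (Ioc 0 1)) :=
    (intervalIntegrable_iff_integrableOn_Ioc_of_le zero_le_one).1
      (intervalIntegral.intervalIntegrable_of_integral_ne_zero (by rw [hf_one]; exact one_ne_zero))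
  rw [intervalIntegral.integral_of_le zero_le_one] at hf_one ⊢
  set m : Measure ℝ := volume.restrict (Ioc 0 1)
  set g : ℕ → ℝ → ℝ := fun n => stepFun fun i => n * p n i
  have hg0 (n : ℕ) (x : ℝ) : 0 ≤ g n x := stepFun_nonneg (fun i => by have := hp n i; positivity) x
  have hgm (n : ℕ) : Measurable (g n) := measurable_stepFun _
  have hφg (n : ℕ) : AEStronglyMeasurable (fun x => φ (g n x)) m :=
    (hφ.measurable.comp (hgm n)).aestronglyMeasurable
  have hmin : ∀ n, ∀ᵐ x ∂m, ‖min (g n x) (f x)‖ ≤ f x := fun n => by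
    filter_upwards [hf.2.1] with x hx
    rw [Real.norm_of_nonneg (le_min (hg0 n x) hx.le)]
    exact min_le_right _ _
  have hminm (n : ℕ) : AEStronglyMeasurable (fun x => min (g n x) (f x)) m :=
    (hgm n).aestronglyMeasurable.inf hfint.aestronglyMeasurable
  have hmini (n : ℕ) : Integrable (fun x => min (g n x) (f x)) m :=
    hfint.mono' (hminm n) (hmin n)
  have hmin_lim : ∀ᵐ x ∂m, Tendsto (fun n => min (g n x) (f x)) atTop (𝓝 (f x)) := by
    filter_upwards [ae_tendsto_stepFun hp hf] with x hx
    simpa using hx.min (tendsto_const_nhds (x := f x))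
  have hA : Tendsto (fun n => ∫ x, min (g n x) (f x) ∂m) atTop (𝓝 1) := by
    rw [← hf_one]
    exact tendsto_integral_of_dominated_convergence f hminm hfint hmin hmin_lim
  have hB : Tendsto (fun n => ∫ x, min (g n x) (f x) * φ (g n x) ∂m) atTop
      (𝓝 (∫ x, f x * φ (f x) ∂m)) := by
    refine tendsto_integral_of_dominated_convergence f (fun n => (hminm n).mul (hφg n)) hfint
      (fun n => ?_) ?_
    · filter_upwards [hmin n] with x hx
      rw [norm_mul]
      exact (mul_le_of_le_one_right (norm_nonneg _) (hφ1 _ (hg0 n x))).trans hx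
    · filter_upwards [hmin_lim, ae_tendsto_stepFun hp hf] with x hx hx'
      exact hx.mul ((hφ.tendsto _).comp hx')
  have hstep (n : ℕ) (hn : 0 < n) (ρ : ℝ → ℝ) : Integrable (fun x => ρ (g n x)) m ∧
      ∫ x, ρ (g n x) ∂m = (n : ℝ)⁻¹ * ∑ i, ρ (n * p n i) := by
    have := integral_comp_stepFun hn (fun i => n * p n i) ρ
    rwa [intervalIntegrable_iff_integrableOn_Ioc_of_le zero_le_one,
      intervalIntegral.integral_of_le zero_le_one] at this
  have hC : Tendsto (fun n => ∫ x, (g n x - min (g n x) (f x)) * φ (g n x) ∂m) atTop (𝓝 0) := by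
    refine squeeze_zero_norm' ?_ (by simpa using (tendsto_const_nhds (x := (1 : ℝ))).sub hA)
    filter_upwards [eventually_gt_atTop 0] with n hn
    have hn' : (n : ℝ) ≠ 0 := by exact_mod_cast hn.ne'
    have h1 := hstep n hn id
    simp only [id] at h1
    rw [← Finset.mul_sum, hp_one n hn, mul_one, inv_mul_cancel₀ hn'] at h1
    rw [← h1.2, ← integral_sub h1.1 (hmini n)]
    refine norm_integral_le_of_norm_le (h1.1.sub (hmini n)) (.of_forall fun x => ?_)
    have hx : 0 ≤ g n x - min (g n x) (f x) := sub_nonneg.2 (min_le_left _ _)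
    rw [norm_mul, Real.norm_of_nonneg hx]
    exact mul_le_of_le_one_right hx (hφ1 _ (hg0 n x))
  have hBC := hC.add hB
  rw [zero_add] at hBC
  refine hBC.congr' ?_
  filter_upwards [eventually_gt_atTop 0] with n hn
  have hn' : (n : ℝ) ≠ 0 := by exact_mod_cast hn.ne'
  have h1 := hstep n hn fun t => t * φ t
  have hi : Integrable (fun x => min (g n x) (f x) * φ (g n x)) m :=
    (hmini n).mul_bdd (hφg n) (.of_forall fun x => hφ1 _ (hg0 n x))
  have e : (fun x => (g n x - min (g n x) (f x)) * φ (g n x)) =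
      fun x => g n x * φ (g n x) - min (g n x) (f x) * φ (g n x) := by
    ext x; ring
  rw [e, integral_sub h1.1 hi, sub_add_cancel, h1.2, Finset.mul_sum]
  refine Finset.sum_congr rfl fun i _ => ?_
  field_simp

end RiemannSums

/-! ### Hits seen from a request -/

section Hits

variable {ι : Type*}

lemma requestedWithin_shift (s t : ℝ) (μ : Measure ℝ) :
    RequestedWithin (shift s μ) (t : EReal) ↔ s ∈ preceded t μ := by
  have hneg (x : ℝ) : -(t : EReal) ≤ (x : EReal) ↔ -t ≤ x := by
    rw [← EReal.coe_neg, EReal.coe_le_coe_iff]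
  constructor
  · rintro ⟨x, h0, h1, h2⟩
    rw [shift_singleton] at h0
    rw [hneg] at h1
    exact ⟨x + s, by linarith, by linarith, h0⟩
  · rintro ⟨x, h1, h2, h0⟩
    exact ⟨x - s, by rwa [shift_singleton, sub_add_cancel], (hneg _).2 (by linarith), by linarith⟩

lemma RequestedWithin.mono {μ : Measure ℝ} {S T : EReal} (h : RequestedWithin μ S) (hST : S ≤ T) :
    RequestedWithin μ T := by
  obtain ⟨x, h0, h1, h2⟩ := h
  exact ⟨x, h0, (EReal.neg_le_neg_iff.2 hST).trans h1, h2⟩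

lemma numRequested_mono [Finite ι] (μ : ι → Measure ℝ) {S T : EReal} (hST : S ≤ T) :
    numRequested μ S ≤ numRequested μ T :=
  ncard_le_ncard (fun _ hi => RequestedWithin.mono hi hST) (toFinite _)

lemma evictionTime_le {μ : ι → Measure ℝ} {C : ℝ} {T : EReal} (h : C ≤ numRequested μ T) :
    evictionTime C μ ≤ T :=
  sInf_le h

lemma le_evictionTime [Finite ι] {μ : ι → Measure ℝ} {C : ℝ} {T : EReal}
    (h : numRequested μ T < C) : T ≤ evictionTime C μ := by
  refine le_sInf fun S hS => ?_
  by_contra! hlt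
  have h1 : (numRequested μ S : ℝ) ≤ numRequested μ T := by
    exact_mod_cast numRequested_mono μ hlt.le
  have h2 : C ≤ numRequested μ S := hS
  linarith

/-- The number of processes in `T` with a point in `B`. -/
noncomputable def activeCount (T : Finset ι) (B : Set ℝ) (μ : ι → Measure ℝ) : ℝ :=
  ∑ j ∈ T, {κ : Measure ℝ | κ B ≠ 0}.indicator 1 (μ j)

lemma numRequested_eq_sum [Fintype ι] (μ : ι → Measure ℝ) (T : EReal) :
    (numRequested μ T : ℝ) = ∑ j, {κ | RequestedWithin κ T}.indicator 1 (μ j) := by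
  classical
  rw [numRequested, Set.ncard_eq_toFinset_card', Set.toFinset_ofPred]
  simp [Set.indicator_apply]

lemma indicator_one_le_indicator_one {α β R : Type*} [Zero R] [One R] [Preorder R]
    [ZeroLEOneClass R] {A : Set α} {B : Set β} {x : α} {y : β} (h : x ∈ A → y ∈ B) :
    A.indicator (1 : α → R) x ≤ B.indicator (1 : β → R) y := by
  by_cases hx : x ∈ A
  · rw [indicator_of_mem hx, indicator_of_mem (h hx), Pi.one_apply, Pi.one_apply]
  · rw [indicator_of_notMem hx]
    exact indicator_nonneg (fun _ _ => zero_le_one) _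

lemma IsSimpleConfig.setLIntegral_mono {κ : Measure ℝ} (hκ : IsSimpleConfig κ) {a b : ℝ}
    {g g' : ℝ → ℝ≥0∞} (hg : ∀ s ∈ Ioc a b, κ {s} ≠ 0 → g s ≤ g' s) :
    ∫⁻ s in Ioc a b, g s ∂κ ≤ ∫⁻ s in Ioc a b, g' s ∂κ := by
  obtain ⟨F, hF, hint⟩ := hκ.exists_finset a b
  rw [hint, hint]
  exact Finset.sum_le_sum fun s hs => hg s ((hF s).1 hs).1 ((hF s).1 hs).2

/-! ### Comparison of LRU hits with recent requests, in one cell -/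

section Cells

variable [Fintype ι] [DecidableEq ι] {μ : ι → Measure ℝ} (hμ : ∀ i, IsSimpleConfig (μ i))

lemma activeCount_erase_le_add_one (i : ι) (B : Set ℝ) (μ : ι → Measure ℝ) :
    activeCount Finset.univ B μ ≤ activeCount (Finset.univ.erase i) B μ + 1 := by
  rw [activeCount, activeCount, ← Finset.sum_erase_add _ _ (Finset.mem_univ i)]
  gcongr
  exact indicator_le_self' (fun _ _ => zero_le_one) _

lemma activeCount_erase_le (i : ι) (B : Set ℝ) (μ : ι → Measure ℝ) :
    activeCount (Finset.univ.erase i) B μ ≤ activeCount Finset.univ B μ :=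
  Finset.sum_le_sum_of_subset_of_nonneg (Finset.erase_subset i _) fun _ _ _ =>
    indicator_nonneg (fun _ _ => zero_le_one) _

include hμ

lemma activeCount_le_numRequested {u h t s : ℝ} (hs : s ∈ Ioc u (u + h)) (i : ι) :
    activeCount (Finset.univ.erase i) (Ioc (u + h - t) u) μ ≤
      numRequested (fun j => shift s (μ j)) t := by
  rw [numRequested_eq_sum]
  refine (activeCount_erase_le i _ μ).trans (Finset.sum_le_sum fun j _ =>
    indicator_one_le_indicator_one fun hj => ?_)
  obtain ⟨x, hx, hx0⟩ := ((hμ j).ne_zero_iff measurableSet_Ioc).1 hj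
  exact (requestedWithin_shift s t (μ j)).2
    ⟨x, by linarith [hx.1, hs.2], by linarith [hx.2, hs.1], hx0⟩

lemma numRequested_le_activeCount {u h t s : ℝ} (hs : s ∈ Ioc u (u + h)) (i : ι) :
    numRequested (fun j => shift s (μ j)) t ≤
      activeCount (Finset.univ.erase i) (Ioc (u - t) (u + h)) μ + 1 := by
  rw [numRequested_eq_sum]
  refine (Finset.sum_le_sum fun j _ => indicator_one_le_indicator_one fun hj => ?_).trans
    (activeCount_erase_le_add_one i _ μ)
  obtain ⟨x, h1, h2, h0⟩ := (requestedWithin_shift s t (μ j)).1 hj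
  exact ((hμ j).ne_zero_iff measurableSet_Ioc).2
    ⟨x, ⟨by linarith [hs.1], by linarith [hs.2]⟩, h0⟩

/-- If at least `C` other contents are active in a window contained in every `[s - t, s)` with `s`
in the cell, then the eviction time is at most `t` and a hit on `i` is preceded by a request within
`t`. The last term covers a simultaneous request for another content, which could realise the hit
event instead of `i`. -/
lemma hit_cell_le (C u h t : ℝ) (i : ι) :
    ∫⁻ s in Ioc u (u + h), (lruHitEvent C).indicator 1 (fun j => shift s (μ j)) ∂(μ i) ≤
      ∫⁻ s in Ioc u (u + h), (preceded t (μ i)).indicator 1 s ∂(μ i) +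
      μ i (Ioc u (u + h)) * (Iio C).indicator 1
        (activeCount (Finset.univ.erase i) (Ioc (u + h - t) u) μ) +
      μ i (Ioc u (u + h)) * (Ici 1).indicator 1
        (activeCount (Finset.univ.erase i) (Ioc u (u + h)) μ) := by
  rw [mul_comm, ← setLIntegral_const, ← lintegral_add_right _ measurable_const,
    mul_comm, ← setLIntegral_const, ← lintegral_add_right _ measurable_const]
  refine setLIntegral_mono' measurableSet_Ioc fun s hs => ?_
  by_cases hhit : (fun j => shift s (μ j)) ∈ lruHitEvent C
  swap
  · rw [indicator_of_notMem hhit]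
    exact zero_le
  rw [indicator_of_mem hhit, Pi.one_apply]
  obtain ⟨j, hj0, hj⟩ := hhit
  rw [shift_singleton, zero_add] at hj0
  by_cases hji : j = i
  swap
  · refine le_add_left (le_of_eq ?_)
    rw [indicator_of_mem, Pi.one_apply]
    have h1 : μ j ∈ {κ : Measure ℝ | κ (Ioc u (u + h)) ≠ 0} :=
      ((hμ j).ne_zero_iff measurableSet_Ioc).2 ⟨s, hs, hj0⟩
    refine le_of_eq_of_le ?_ (Finset.single_le_sum
      (f := fun j => {κ : Measure ℝ | κ (Ioc u (u + h)) ≠ 0}.indicator (1 : Measure ℝ → ℝ) (μ j))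
      (fun _ _ => indicator_nonneg (fun _ _ => zero_le_one) _)
      (Finset.mem_erase.2 ⟨hji, Finset.mem_univ j⟩))
    rw [indicator_of_mem h1, Pi.one_apply]
  subst hji
  refine le_add_right ?_
  by_cases hC : activeCount (Finset.univ.erase j) (Ioc (u + h - t) u) μ < C
  · refine le_add_left (le_of_eq ?_)
    rw [indicator_of_mem (mem_Iio.2 hC), Pi.one_apply]
  · refine le_add_right (le_of_eq ?_)
    rw [indicator_of_mem, Pi.one_apply]
    exact (requestedWithin_shift s t (μ j)).1 (hj.mono
      (evictionTime_le ((not_lt.1 hC).trans (activeCount_le_numRequested hμ hs j))))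

/-- Here the window contains every `[s - t, s)`. The threshold is `C - 1` because content `i`
itself, left out of the count, may contribute one. -/
lemma preceded_cell_le (C u h t : ℝ) (i : ι) :
    ∫⁻ s in Ioc u (u + h), (preceded t (μ i)).indicator 1 s ∂(μ i) ≤
      ∫⁻ s in Ioc u (u + h), (lruHitEvent C).indicator 1 (fun j => shift s (μ j)) ∂(μ i) +
      μ i (Ioc u (u + h)) * (Ici (C - 1)).indicator 1
        (activeCount (Finset.univ.erase i) (Ioc (u - t) (u + h)) μ) := by
  rw [mul_comm, ← setLIntegral_const, ← lintegral_add_right _ measurable_const]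
  refine (hμ i).setLIntegral_mono fun s hs hs0 => ?_
  by_cases hC : (numRequested (fun j => shift s (μ j)) t : ℝ) < C
  · refine le_add_right (indicator_one_le_indicator_one fun hprec => ⟨i, ?_, ?_⟩)
    · rwa [shift_singleton, zero_add]
    · exact ((requestedWithin_shift s t (μ i)).2 hprec).mono (le_evictionTime hC)
  · refine le_add_left (indicator_one_le_indicator_one fun _ => mem_Ici.2 ?_)
    linarith [not_lt.1 hC, numRequested_le_activeCount hμ (t := t) hs i]

end Cells

end Hits

/-! ### Summation over cells and contents, using independence -/

section Superposition

variable {Ω : Type*} [MeasurableSpace Ω] {P : Measure Ω} {ι : Type*} {M : ι → Ω → Measure ℝ}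
  (hM : ∀ i, IsStationaryErgodicSimple P (M i))

lemma measurable_activeCount (T : Finset ι) {B : Set ℝ} (hB : MeasurableSet B) :
    Measurable (activeCount T B) :=
  Finset.measurable_fun_sum _ fun j _ =>
    (measurable_one.indicator (measurableSet_apply_ne_zero hB)).comp (measurable_pi_apply j)

include hM

lemma measurable_pi_process : Measurable fun ω j => M j ω :=
  measurable_pi_lambda _ fun j => (hM j).measurable

lemma measurable_indicator_activeCount (T : Finset ι) {B : Set ℝ} (hB : MeasurableSet B)
    {E : Set ℝ} (hE : MeasurableSet E) :
    Measurable fun ω => E.indicator (1 : ℝ → ℝ≥0∞) (activeCount T B fun j => M j ω) :=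
  (measurable_one.indicator hE).comp
    ((measurable_activeCount T hB).comp (measurable_pi_process hM))

/-- The reason for omitting `i` from the count: a deterministic window makes it independent of the
requests for `i`, so the mean factorises. -/
lemma lintegral_mul_indicator_activeCount [Fintype ι] [DecidableEq ι] (hind : iIndepFun M P)
    (i : ι) {J B : Set ℝ} (hJ : MeasurableSet J) (hB : MeasurableSet B) {E : Set ℝ}
    (hE : MeasurableSet E) :
    ∫⁻ ω, M i ω J * E.indicator 1
      (activeCount (Finset.univ.erase i) B fun j => M j ω) ∂P =
      (∫⁻ ω, M i ω J ∂P) *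
        P {ω | activeCount (Finset.univ.erase i) B (fun j => M j ω) ∈ E} := by
  have h1 := hind.indepFun_finset {i} (Finset.univ.erase i) (by simp) fun j => (hM j).measurable
  have hg : Measurable fun v : ({i} : Finset ι) → Measure ℝ => v ⟨i, Finset.mem_singleton_self i⟩ J :=
    (Measure.measurable_coe hJ).comp (measurable_pi_apply _)
  have hk : Measurable fun v : ↥(Finset.univ.erase i) → Measure ℝ =>
      E.indicator (1 : ℝ → ℝ≥0∞) (∑ j, {κ : Measure ℝ | κ B ≠ 0}.indicator 1 (v j)) :=
    (measurable_one.indicator hE).comp (Finset.measurable_fun_sum _ fun j _ =>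
      (measurable_one.indicator (measurableSet_apply_ne_zero hB)).comp (measurable_pi_apply j))
  have h2 := h1.comp hg hk
  have e : (fun v : ↥(Finset.univ.erase i) → Measure ℝ =>
      E.indicator (1 : ℝ → ℝ≥0∞) (∑ j, {κ : Measure ℝ | κ B ≠ 0}.indicator 1 (v j))) ∘
      (fun a j => M j a) =
      fun ω => E.indicator 1 (activeCount (Finset.univ.erase i) B fun j => M j ω) := by
    ext ω
    simp only [Function.comp, activeCount]
    congr 1
    exact Finset.sum_coe_sort (Finset.univ.erase i)
      fun j => {κ : Measure ℝ | κ B ≠ 0}.indicator (1 : Measure ℝ → ℝ) (M j ω)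
  rw [e] at h2
  have h3 := lintegral_mul_eq_lintegral_mul_lintegral_of_indepFun ((hM i).measurable_apply hJ)
    (measurable_indicator_activeCount hM _ hB hE) h2
  have h4 : ∫⁻ ω, E.indicator 1 (activeCount (Finset.univ.erase i) B fun j => M j ω) ∂P =
      P {ω | activeCount (Finset.univ.erase i) B (fun j => M j ω) ∈ E} :=
    lintegral_indicator_one
      ((measurable_activeCount _ hB).comp (measurable_pi_process hM) hE)
  rw [← h4, ← h3]
  rfl

lemma measurable_mul_indicator_activeCount (T : Finset ι) (i : ι) {J B : Set ℝ}
    (hJ : MeasurableSet J) (hB : MeasurableSet B) {E : Set ℝ} (hE : MeasurableSet E) :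
    Measurable fun ω => M i ω J * E.indicator 1 (activeCount T B fun j => M j ω) :=
  ((hM i).measurable_apply hJ).mul (measurable_indicator_activeCount hM _ hB hE)

lemma lintegral_sum_cells_mul_le [Fintype ι] [DecidableEq ι] (hind : iIndepFun M P)
    (i : ι) {m : ℕ} (hm : 0 < m) {B : ℝ → Set ℝ} (hB : ∀ u, MeasurableSet (B u)) {E : Set ℝ}
    (hE : MeasurableSet E) {δ : ℝ≥0∞}
    (hδ : ∀ u, P {ω | activeCount (Finset.univ.erase i) (B u) (fun j => M j ω) ∈ E} ≤ δ) :
    ∫⁻ ω, ∑ k ∈ Finset.range m, M i ω (Ioc ((k : ℝ) / m) (k / m + 1 / m)) * E.indicator 1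
      (activeCount (Finset.univ.erase i) (B ((k : ℝ) / m)) fun j => M j ω) ∂P ≤
      intensity P (M i) * δ := by
  rw [lintegral_finsetSum _ fun k _ =>
    measurable_mul_indicator_activeCount hM _ i measurableSet_Ioc (hB _) hE]
  simp_rw [lintegral_mul_indicator_activeCount hM hind i measurableSet_Ioc (hB _) hE]
  calc _ ≤ ∑ k ∈ Finset.range m, (∫⁻ ω, M i ω (Ioc 0 (0 + 1 / (m : ℝ))) ∂P) * δ := by
        refine Finset.sum_le_sum fun k _ => ?_
        rw [(hM i).lintegral_Ioc, add_sub_cancel_left, zero_add]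
        gcongr
        exact hδ _
    _ = intensity P (M i) * δ := by
        rw [Finset.sum_const, Finset.card_range, nsmul_eq_mul, ← mul_assoc,
          (hM i).lintegral_cell hm]

omit hM in
-- The lower Lebesgue integral of functions not known to be measurable is superadditive but need not
-- be subadditive, so upper bounds go through a measurable majorant: all points minus the number of
-- gap cells. The opposite cell inequality at `t + 1 / m` bounds its mean.
lemma exists_preceded_majorant [IsProbabilityMeasure P] {N : Ω → Measure ℝ}
    (hN : IsStationaryErgodicSimple P N) {m : ℕ} (hm : 0 < m) {t : ℝ} (ht : 0 ≤ t) :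
    ∃ G : Ω → ℝ≥0∞, Measurable G ∧
      (∀ᵐ ω ∂P, ∫⁻ s in Ioc 0 1, (preceded t (N ω)).indicator 1 s ∂(N ω) ≤ G ω) ∧
      ∫⁻ ω, G ω ∂P ≤ precededMean P N (t + 1 / m) := by
  have hh : (0 : ℝ) < 1 / m := by positivity
  set E : ℝ → Set (Measure ℝ) := fun u => gapSet u (u + 1 / m) (u - t) u
  have hE (u : ℝ) : MeasurableSet (E u) := measurableSet_gapSet _ _ _ _
  set S : Ω → ℝ≥0∞ := fun ω => ∑ k ∈ Finset.range m, (E ((k : ℝ) / m)).indicator 1 (N ω)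
  have hS : Measurable S := Finset.measurable_fun_sum _ fun k _ => hN.measurable_indicator (hE _)
  have hSfin (ω : Ω) : S ω ≠ ⊤ := by
    refine ENNReal.sum_ne_top.2 fun k _ => ne_top_of_le_ne_top ENNReal.one_ne_top ?_
    exact indicator_le_self' (fun _ _ => zero_le_one) _
  have hle : ∀ᵐ ω ∂P,
      ∫⁻ s in Ioc 0 1, (preceded t (N ω)).indicator 1 s ∂(N ω) + S ω ≤ N ω (Ioc 0 1) := by
    filter_upwards [hN.simple] with ω hω
    have h2 := lintegral_Ioc_eq_sum_cells (N ω) 1 hm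
    simp only [Pi.one_apply, setLIntegral_one] at h2
    rw [h2, lintegral_Ioc_eq_sum_cells (N ω) _ hm, ← Finset.sum_add_distrib]
    exact Finset.sum_le_sum fun k _ => preceded_add_gap_le hω _ _ _
  refine ⟨fun ω => N ω (Ioc 0 1) - S ω, (hN.measurable_apply measurableSet_Ioc).sub hS, ?_, ?_⟩
  · filter_upwards [hle] with ω hω
    exact ENNReal.le_sub_of_add_le_right (hSfin ω) hω
  · have h1 : ∫⁻ ω, (N ω (Ioc 0 1) - S ω) ∂P + ∫⁻ ω, S ω ∂P = intensity P N := by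
      rw [← lintegral_add_right _ hS, intensity]
      refine lintegral_congr_ae ?_
      filter_upwards [hle] with ω hω
      exact tsub_add_cancel_of_le (le_add_self.trans hω)
    have h2 := hN.lintegral_sum_cells_indicator m hE (a := hitWithin P N t)
      (b := hitWithin P N (t + 1 / m)) fun u => by
        have := hN.measure_gap_left (le_add_of_nonneg_right hh.le : u ≤ u + 1 / m) (sub_le_self u ht)
        rwa [sub_sub_cancel, show u + 1 / m - (u - t) = t + 1 / m by ring] at this
    have h3 := hN.le_precededMean_add hm (le_add_of_nonneg_left ht : 1 / (m : ℝ) ≤ t + 1 / m)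
    rw [add_sub_cancel_right, ← h1, add_assoc, h2] at h3
    refine (ENNReal.add_le_add_iff_right ?_).1 h3
    exact ENNReal.mul_ne_top (ENNReal.natCast_ne_top m) (measure_ne_top _ _)

variable [Fintype ι] [IsProbabilityMeasure P] (hind : iIndepFun M P) {m : ℕ} (hm : 0 < m)
include hind hm

/-- The threshold `C + 1` for the full count absorbs the omission of `i`, so one `δ` serves all
contents. Simultaneous requests are handled by a union bound over a cell. -/
lemma exists_hit_majorant {t : ℝ} (ht : 0 ≤ t) {C : ℝ} {δ : ℝ≥0∞}
    (hδ : ∀ a b : ℝ, b - a = t - 1 / m →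
      P {ω | activeCount Finset.univ (Ioc a b) (fun j => M j ω) < C + 1} ≤ δ) (i : ι) :
    ∃ G : Ω → ℝ≥0∞, Measurable G ∧
      (∀ᵐ ω ∂P, ∫⁻ s in Ioc 0 1,
        (lruHitEvent C).indicator 1 (fun j => shift s (M j ω)) ∂(M i ω) ≤ G ω) ∧
      ∫⁻ ω, G ω ∂P ≤ precededMean P (M i) (t + 1 / m) + intensity P (M i) * δ +
        intensity P (M i) * ∑ j, hitWithin P (M j) (1 / m) := by
  classical
  obtain ⟨G, hG, hGle, hGint⟩ := exists_preceded_majorant (hM i) hm ht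
  have hB (u : ℝ) : MeasurableSet (Ioc (u + 1 / m - t) u) := measurableSet_Ioc
  have hD (u : ℝ) : MeasurableSet (Ioc u (u + 1 / m)) := measurableSet_Ioc
  have hmeas {B : ℝ → Set ℝ} (hB : ∀ u, MeasurableSet (B u)) {E : Set ℝ} (hE : MeasurableSet E) :
      Measurable fun ω => ∑ k ∈ Finset.range m,
        M i ω (Ioc ((k : ℝ) / m) (k / m + 1 / m)) * E.indicator 1
        (activeCount (Finset.univ.erase i) (B ((k : ℝ) / m)) fun j => M j ω) :=
    Finset.measurable_fun_sum _ fun k _ =>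
      measurable_mul_indicator_activeCount hM _ i measurableSet_Ioc (hB _) hE
  refine ⟨fun ω => G ω + (∑ k ∈ Finset.range m, M i ω (Ioc ((k : ℝ) / m) (k / m + 1 / m)) *
      (Iio C).indicator 1 (activeCount (Finset.univ.erase i)
        (Ioc ((k : ℝ) / m + 1 / m - t) (k / m)) fun j => M j ω)) +
    ∑ k ∈ Finset.range m, M i ω (Ioc ((k : ℝ) / m) (k / m + 1 / m)) *
      (Ici 1).indicator 1 (activeCount (Finset.univ.erase i)
        (Ioc ((k : ℝ) / m) (k / m + 1 / m)) fun j => M j ω),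
    (hG.add (hmeas hB measurableSet_Iio)).add (hmeas hD measurableSet_Ici), ?_, ?_⟩
  · filter_upwards [hGle, ae_all_iff.2 fun j => (hM j).simple] with ω hω hsimple
    refine le_trans ?_ (add_le_add_left (add_le_add_left hω _) _)
    rw [lintegral_Ioc_eq_sum_cells _ _ hm, lintegral_Ioc_eq_sum_cells _ _ hm,
      ← Finset.sum_add_distrib, ← Finset.sum_add_distrib]
    exact Finset.sum_le_sum fun k _ => hit_cell_le hsimple _ _ _ _ _
  · rw [lintegral_add_right _ (hmeas hD measurableSet_Ici),
      lintegral_add_right _ (hmeas hB measurableSet_Iio)]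
    refine add_le_add (add_le_add hGint ?_) ?_
    · refine lintegral_sum_cells_mul_le hM hind i hm hB measurableSet_Iio fun u => ?_
      refine (measure_mono fun ω hω => ?_).trans (hδ (u + 1 / m - t) u (by ring))
      have h1 : activeCount (Finset.univ.erase i) (Ioc (u + 1 / m - t) u) (fun j => M j ω) < C := hω
      change activeCount Finset.univ (Ioc (u + 1 / m - t) u) (fun j => M j ω) < C + 1
      linarith [activeCount_erase_le_add_one i (Ioc (u + 1 / m - t) u) fun j => M j ω]
    · refine lintegral_sum_cells_mul_le hM hind i hm hD measurableSet_Ici fun u => ?_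
      have hsub : {ω | activeCount (Finset.univ.erase i) (Ioc u (u + 1 / m)) (fun j => M j ω) ∈ Ici 1}
          ⊆ ⋃ j ∈ (Finset.univ : Finset ι), {ω | M j ω (Ioc u (u + 1 / m)) ≠ 0} := by
        intro ω hω
        by_contra hnot
        simp only [mem_iUnion, not_exists] at hnot
        have h0 : activeCount (Finset.univ.erase i) (Ioc u (u + 1 / m)) (fun j => M j ω) = 0 :=
          Finset.sum_eq_zero fun j _ => indicator_of_notMem
            (s := {κ : Measure ℝ | κ (Ioc u (u + 1 / m)) ≠ 0}) (hnot j (Finset.mem_univ j)) _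
        have h1 : 1 ≤ activeCount (Finset.univ.erase i) (Ioc u (u + 1 / m)) (fun j => M j ω) := hω
        linarith
      refine (measure_mono hsub).trans ((measure_biUnion_finset_le _ _).trans_eq ?_)
      refine Finset.sum_congr rfl fun j _ => ?_
      rw [(hM j).measure_Ioc_ne_zero, add_sub_cancel_left]

omit [IsProbabilityMeasure P] in
lemma precededMean_le_hit_add {t : ℝ} {C : ℝ} {δ : ℝ≥0∞}
    (hδ : ∀ a b : ℝ, b - a = t + 1 / m →
      P {ω | C - 1 ≤ activeCount Finset.univ (Ioc a b) (fun j => M j ω)} ≤ δ) (i : ι) :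
    precededMean P (M i) t ≤ ∫⁻ ω, ∫⁻ s in Ioc 0 1,
      (lruHitEvent C).indicator 1 (fun j => shift s (M j ω)) ∂(M i ω) ∂P +
      intensity P (M i) * δ := by
  classical
  have hB (u : ℝ) : MeasurableSet (Ioc (u - t) (u + 1 / m)) := measurableSet_Ioc
  refine le_trans ?_ (add_le_add_right (lintegral_sum_cells_mul_le hM hind i hm hB
    (measurableSet_Ici (a := C - 1)) fun u => ?_) _)
  · rw [← lintegral_add_right _ (Finset.measurable_fun_sum _ fun k _ =>
      measurable_mul_indicator_activeCount hM _ i measurableSet_Ioc (hB _) measurableSet_Ici)]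
    refine lintegral_mono_ae ?_
    filter_upwards [ae_all_iff.2 fun j => (hM j).simple] with ω hsimple
    rw [lintegral_Ioc_eq_sum_cells _ _ hm, lintegral_Ioc_eq_sum_cells _ _ hm,
      ← Finset.sum_add_distrib]
    exact Finset.sum_le_sum fun k _ => preceded_cell_le hsimple _ _ _ _ _
  · refine (measure_mono fun ω hω => ?_).trans (hδ (u - t) (u + 1 / m) (by ring))
    have h1 : C - 1 ≤ activeCount (Finset.univ.erase i) (Ioc (u - t) (u + 1 / m)) fun j => M j ω :=
      hω
    exact h1.trans (activeCount_erase_le _ _ _)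

omit hM [IsProbabilityMeasure P] hind hm in
lemma lintegral_superposition (C : ℝ) (μ : ι → Measure ℝ) :
    ∫⁻ s in Ioc 0 1, (lruHitEvent C).indicator 1 (fun j => shift s (μ j)) ∂(∑ i, μ i) =
      ∑ i, ∫⁻ s in Ioc 0 1, (lruHitEvent C).indicator 1 (fun j => shift s (μ j)) ∂(μ i) := by
  simp_rw [← lintegral_indicator measurableSet_Ioc]
  exact lintegral_finsetSum_measure _ _ _

omit [IsProbabilityMeasure P] hind hm in
lemma intensity_superposition :
    intensity P (fun ω => ∑ i, M i ω) = ∑ i, intensity P (M i) := by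
  simp_rw [intensity, Measure.finsetSum_apply]
  exact lintegral_finsetSum _ fun i _ => (hM i).measurable_apply measurableSet_Ioc

lemma hit_mass_le {t : ℝ} (ht : 0 ≤ t) {C : ℝ} {δ : ℝ≥0∞}
    (hδ : ∀ a b : ℝ, b - a = t - 1 / m →
      P {ω | activeCount Finset.univ (Ioc a b) (fun j => M j ω) < C + 1} ≤ δ) :
    ∫⁻ ω, ∫⁻ s in Ioc 0 1, (lruHitEvent C).indicator 1 (fun j => shift s (M j ω))
        ∂(∑ i, M i ω) ∂P ≤
      ∑ i, (precededMean P (M i) (t + 1 / m) + intensity P (M i) * δ +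
        intensity P (M i) * ∑ j, hitWithin P (M j) (1 / m)) := by
  choose G hG hGle hGint using exists_hit_majorant hM hind hm ht hδ
  simp_rw [lintegral_superposition]
  calc _ ≤ ∫⁻ ω, ∑ i, G i ω ∂P := by
        refine lintegral_mono_ae ?_
        filter_upwards [ae_all_iff.2 hGle] with ω hω
        exact Finset.sum_le_sum fun i _ => hω i
    _ = ∑ i, ∫⁻ ω, G i ω ∂P := lintegral_finsetSum _ fun i _ => hG i
    _ ≤ _ := Finset.sum_le_sum fun i _ => hGint i

omit hM [IsProbabilityMeasure P] hind hm [Fintype ι] in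
lemma sum_lintegral_le (T : Finset ι) (F : ι → Ω → ℝ≥0∞) :
    ∑ i ∈ T, ∫⁻ ω, F i ω ∂P ≤ ∫⁻ ω, ∑ i ∈ T, F i ω ∂P := by
  classical
  induction T using Finset.induction_on with
  | empty => simp
  | insert i T hi ih =>
    simp_rw [Finset.sum_insert hi]
    -- Superadditivity of the integral holds without measurability, which is why the lower bound on
    -- the hit mass needs no majorants.
    exact (add_le_add_right ih _).trans (le_lintegral_add _ _)

omit [IsProbabilityMeasure P] in
lemma le_hit_mass {t : ℝ} {C : ℝ} {δ : ℝ≥0∞}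
    (hδ : ∀ a b : ℝ, b - a = t + 1 / m →
      P {ω | C - 1 ≤ activeCount Finset.univ (Ioc a b) (fun j => M j ω)} ≤ δ) :
    ∑ i, precededMean P (M i) t ≤ ∫⁻ ω, ∫⁻ s in Ioc 0 1,
      (lruHitEvent C).indicator 1 (fun j => shift s (M j ω)) ∂(∑ i, M i ω) ∂P +
      (∑ i, intensity P (M i)) * δ := by
  simp_rw [lintegral_superposition]
  refine (Finset.sum_le_sum fun i _ => precededMean_le_hit_add hM hind hm hδ i).trans ?_
  rw [Finset.sum_add_distrib, ← Finset.sum_mul]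
  gcongr
  exact sum_lintegral_le _ _

end Superposition

/-! ### Concentration of the number of active contents -/

section Concentration

variable {Ω : Type*} [MeasurableSpace Ω] {P : Measure Ω} [IsProbabilityMeasure P] {ι : Type*}
  [Fintype ι] {M : ι → Ω → Measure ℝ} (hM : ∀ i, IsStationaryErgodicSimple P (M i))
  (hind : iIndepFun M P)
include hM hind

lemma measure_activeCount_deviation_le (a b : ℝ) {c : ℝ} (hc : 0 < c) :
    P {ω | c ≤ |activeCount Finset.univ (Ioc a b) (fun j => M j ω) -
      ∑ j, (hitWithin P (M j) (b - a)).toReal|} ≤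
      ENNReal.ofReal ((Fintype.card ι : ℝ) / c ^ 2) := by
  set A : Set (Measure ℝ) := {κ | κ (Ioc a b) ≠ 0}
  have hA : MeasurableSet A := measurableSet_apply_ne_zero measurableSet_Ioc
  set X : ι → Ω → ℝ := fun j ω => A.indicator 1 (M j ω)
  have hg : Measurable (A.indicator (1 : Measure ℝ → ℝ)) := measurable_one.indicator hA
  have hX (j : ι) : Measurable (X j) := hg.comp (hM j).measurable
  have hX01 (j : ι) (ω : Ω) : X j ω ∈ Icc (0 : ℝ) 1 :=
    ⟨indicator_nonneg (fun _ _ => zero_le_one) _, indicator_le_self' (fun _ _ => zero_le_one) _⟩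
  have hXL (j : ι) : MemLp (X j) 2 P := by
    refine MemLp.of_bound (hX j).aestronglyMeasurable 1 (.of_forall fun ω => ?_)
    rw [Real.norm_of_nonneg (hX01 j ω).1]
    exact (hX01 j ω).2
  have hXind : iIndepFun X P := hind.comp (fun _ => A.indicator 1) fun _ => hg
  have hmean (j : ι) : ∫ ω, X j ω ∂P = (hitWithin P (M j) (b - a)).toReal := by
    rw [← (hM j).measure_Ioc_ne_zero a b]
    exact integral_indicator_one ((hM j).measurable hA)
  have hvar : Var[∑ j, X j; P] ≤ Fintype.card ι := by
    rw [IndepFun.variance_sum (fun j _ => hXL j) fun i _ j _ hij => hXind.indepFun hij]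
    calc _ ≤ ∑ _j : ι, (1 : ℝ) := by
          refine Finset.sum_le_sum fun j _ => ?_
          refine (variance_le_sq_of_bounded (.of_forall (hX01 j)) (hX j).aemeasurable).trans ?_
          norm_num
      _ = _ := by simp
  have h := meas_ge_le_variance_div_sq (memLp_finsetSum' Finset.univ fun j _ => hXL j) hc
  have hint : ∫ ω, (∑ j, X j) ω ∂P = ∑ j, (hitWithin P (M j) (b - a)).toReal := by
    simp_rw [Finset.sum_apply]
    rw [integral_finsetSum _ fun j _ => (hXL j).integrable one_le_two]
    simp_rw [hmean]
  rw [hint] at h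
  simp_rw [Finset.sum_apply] at h
  refine h.trans (ENNReal.ofReal_le_ofReal ?_)
  gcongr

end Concentration

/-! ### Bounds on the hit probability for a fixed number of contents -/

section FixedNumber

variable {Ω : Type*} [MeasurableSpace Ω] {P : Measure Ω} [IsProbabilityMeasure P] {n : ℕ}
  {M : Fin n → Ω → Measure ℝ} (hM : ∀ i, IsStationaryErgodicSimple P (M i))
  (hind : iIndepFun M P) (hpos : ∀ i, 0 < intensity P (M i)) (hlt : ∀ i, intensity P (M i) < ⊤)
  {ψ : Measure ℝ} (hψ : ∀ i t, stdInterRequestCdf P M i t = cdf ψ t)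

include hpos hlt in
omit [IsProbabilityMeasure P] in
lemma rate_pos (i : Fin n) : 0 < rate P M i := ENNReal.toReal_pos (hpos i).ne' (hlt i).ne

include hpos hlt in
omit [IsProbabilityMeasure P] in
lemma sum_rate_pos (hn : 0 < n) : 0 < ∑ j, rate P M j :=
  Finset.sum_pos (fun i _ => rate_pos hpos hlt i) ⟨⟨0, hn⟩, Finset.mem_univ _⟩

include hpos hlt in
omit [IsProbabilityMeasure P] in
lemma popularity_pos (i : Fin n) : 0 < popularity P M i :=
  div_pos (rate_pos hpos hlt i) (sum_rate_pos hpos hlt i.pos)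

include hpos hlt in
omit [IsProbabilityMeasure P] in
lemma sum_popularity (hn : 0 < n) : ∑ i, popularity P M i = 1 := by
  simp_rw [popularity]
  rw [← Finset.sum_div, div_self (sum_rate_pos hpos hlt hn).ne']

omit [IsProbabilityMeasure P] in
lemma rate_mul_time (i : Fin n) (ν : ℝ) :
    rate P M i * (ν * n / ∑ j, rate P M j) = ν * (n * popularity P M i) := by
  rw [popularity]
  ring

include hM hψ in
omit [IsProbabilityMeasure P] in
lemma followedMean_div_intensity (i : Fin n) (t : ℝ) :
    (followedMean P (M i) (t / (intensity P (M i)).toReal) / intensity P (M i)).toReal =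
      cdf ψ t := by
  rw [← hψ i t, stdInterRequestCdf, interRequestCdf, palm_nextPoint (hM i), rate]

include hM hpos hlt hψ

lemma hitWithin_eq (i : Fin n) {t : ℝ} (ht : 0 ≤ t) :
    (hitWithin P (M i) t).toReal = excessCdf ψ (rate P M i * t) :=
  (hM i).toReal_hitWithin (hpos i) (hlt i) (followedMean_div_intensity hM hψ i) ht

lemma precededMean_eq (hψcont : Continuous (cdf ψ)) (i : Fin n) {t : ℝ} (ht : 0 < t) :
    (precededMean P (M i) t).toReal = rate P M i * cdf ψ (rate P M i * t) :=
  (hM i).toReal_precededMean (hpos i) (hlt i) (followedMean_div_intensity hM hψ i) hψcont ht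

omit hψ hpos hlt [IsProbabilityMeasure P] in
lemma hitProbLRU_eq (C : ℝ) : hitProbLRU P M C =
    (∫⁻ ω, ∫⁻ s in Ioc 0 1, (lruHitEvent C).indicator 1 (fun j => shift s (M j ω))
      ∂(∑ i, M i ω) ∂P).toReal / (∑ i, intensity P (M i)).toReal := by
  rw [hitProbLRU, palm, intensity_superposition hM, ENNReal.toReal_div]

omit hψ hpos hM [IsProbabilityMeasure P] in
lemma toReal_sum_intensity : (∑ i, intensity P (M i)).toReal = ∑ i, rate P M i :=
  ENNReal.toReal_sum fun i _ => (hlt i).ne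

omit hψ hpos [IsProbabilityMeasure P] in
lemma hit_mass_ne_top (C : ℝ) :
    ∫⁻ ω, ∫⁻ s in Ioc 0 1, (lruHitEvent C).indicator 1 (fun j => shift s (M j ω))
      ∂(∑ i, M i ω) ∂P ≠ ⊤ := by
  have h : ∑ i, intensity P (M i) ≠ ⊤ := ENNReal.sum_ne_top.2 fun i _ => (hlt i).ne
  rw [← intensity_superposition hM] at h
  refine ne_top_of_le_ne_top h (lintegral_mono fun ω => ?_)
  beta_reduce
  rw [← setLIntegral_one]
  exact lintegral_mono fun s => indicator_le_self' (fun _ _ => zero_le_one) _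

include hind

lemma hitProbLRU_le (hψcont : Continuous (cdf ψ)) (hn : 0 < n) {ν ν' κ C : ℝ} (hν' : 0 < ν')
    (hνν' : ν' < ν) (hκ : 0 < κ)
    (hC : C + 1 ≤ ∑ j, excessCdf ψ (ν' * (n * popularity P M j)) - κ * n) :
    hitProbLRU P M C ≤ ∑ i, popularity P M i * cdf ψ (ν * (n * popularity P M i)) +
      1 / κ ^ 2 / n + 1 / n := by
  set Λ := ∑ j, rate P M j with hΛ
  have hΛ0 : 0 < Λ := sum_rate_pos hpos hlt hn
  have hn' : (0 : ℝ) < n := by exact_mod_cast hn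
  set t := ν * n / Λ with ht
  set t' := ν' * n / Λ with ht'
  have htt' : t' < t := by rw [ht, ht']; gcongr
  have ht'0 : 0 < t' := by positivity
  -- The first condition makes simultaneous requests in a cell cost at most `1 / n`. The second pays
  -- for two cell lengths: one for the majorant, one for fitting the window to the cell.
  obtain ⟨m, hm, hm1, hm2⟩ : ∃ m : ℕ, 0 < m ∧ Λ * (1 / (m : ℝ)) ≤ 1 / n ∧
      2 * (1 / (m : ℝ)) ≤ t - t' := by
    have hinv : Tendsto (fun m : ℕ => 1 / (m : ℝ)) atTop (𝓝 0) :=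
      tendsto_one_div_atTop_nhds_zero_nat
    have h1 := hinv.const_mul Λ
    have h2 := hinv.const_mul 2
    rw [mul_zero] at h1 h2
    have hpos1 : (0 : ℝ) < 1 / n := by positivity
    exact ((eventually_gt_atTop 0).and ((h1.eventually_le_const hpos1).and
      (h2.eventually_le_const (sub_pos.2 htt')))).exists
  have hm0 : (0 : ℝ) < 1 / m := by positivity
  set δ : ℝ≥0∞ := ENNReal.ofReal (1 / κ ^ 2 / n)
  have hδ : ∀ a b : ℝ, b - a = t - 1 / m - 1 / m →
      P {ω | activeCount Finset.univ (Ioc a b) (fun j => M j ω) < C + 1} ≤ δ := by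
    intro a b hab
    have h := measure_activeCount_deviation_le hM hind a b (c := κ * n) (by positivity)
    -- Chebyshev with variance at most `n` and deviation `κ * n`.
    have e : (Fintype.card (Fin n) : ℝ) / (κ * n) ^ 2 = 1 / κ ^ 2 / n := by
      rw [Fintype.card_fin]
      field_simp
    rw [e] at h
    refine (measure_mono fun ω hω => ?_).trans h
    have hω' : activeCount Finset.univ (Ioc a b) (fun j => M j ω) < C + 1 := hω
    have hsum : ∑ j, excessCdf ψ (ν' * (n * popularity P M j)) ≤
        ∑ j, (hitWithin P (M j) (b - a)).toReal := by
      refine Finset.sum_le_sum fun j _ => ?_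
      rw [hitWithin_eq hM hpos hlt hψ j (by linarith), ← rate_mul_time]
      refine monotone_excessCdf (mul_le_mul_of_nonneg_left ?_ (rate_pos hpos hlt j).le)
      linarith
    change κ * n ≤ |_|
    rw [le_abs]
    right
    linarith
  have hmass := hit_mass_le hM hind hm (t := t - 1 / m) (by linarith) hδ
  rw [sub_add_cancel] at hmass
  have hprec (i : Fin n) : precededMean P (M i) t ≠ ⊤ :=
    ((IsStationaryErgodicSimple.precededMean_le t).trans_lt (hlt i)).ne
  have hδtop : δ ≠ ⊤ := ENNReal.ofReal_ne_top
  have hqtop (j : Fin n) : hitWithin P (M j) (1 / m) ≠ ⊤ := measure_ne_top _ _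
  have hqsum : ∑ j, hitWithin P (M j) (1 / m) ≠ ⊤ := ENNReal.sum_ne_top.2 fun j _ => hqtop j
  have h1 (i : Fin n) : intensity P (M i) * δ ≠ ⊤ := ENNReal.mul_ne_top (hlt i).ne hδtop
  have h2 (i : Fin n) : intensity P (M i) * ∑ j, hitWithin P (M j) (1 / m) ≠ ⊤ :=
    ENNReal.mul_ne_top (hlt i).ne hqsum
  have hterm (i : Fin n) : precededMean P (M i) t + intensity P (M i) * δ +
      intensity P (M i) * ∑ j, hitWithin P (M j) (1 / m) ≠ ⊤ :=
    ENNReal.add_ne_top.2 ⟨ENNReal.add_ne_top.2 ⟨hprec i, h1 i⟩, h2 i⟩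
  have hmass' := ENNReal.toReal_mono (ENNReal.sum_ne_top.2 fun i _ => hterm i) hmass
  rw [ENNReal.toReal_sum fun i _ => hterm i] at hmass'
  have hq : (∑ j, hitWithin P (M j) (1 / m)).toReal ≤ 1 / n := by
    rw [ENNReal.toReal_sum fun j _ => hqtop j]
    refine le_trans (Finset.sum_le_sum fun j _ => ?_) (b := ∑ j, rate P M j * (1 / m)) ?_
    · rw [hitWithin_eq hM hpos hlt hψ j hm0.le]
      have hr : 0 ≤ rate P M j * (1 / m) := mul_nonneg (rate_pos hpos hlt j).le hm0.le
      have := excessCdf_sub_le (ψ := ψ) hr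
      rw [excessCdf_zero, sub_zero, sub_zero] at this
      exact this.trans (mul_le_of_le_one_right hr (by linarith [cdf_nonneg ψ 0]))
    · rw [← Finset.sum_mul]
      exact hm1
  rw [hitProbLRU_eq hM, toReal_sum_intensity hlt, div_le_iff₀ hΛ0]
  refine hmass'.trans (le_of_le_of_eq (Finset.sum_le_sum fun i _ => ?_)
    (b := ∑ i, (rate P M i * cdf ψ (ν * (n * popularity P M i)) +
      rate P M i * (1 / κ ^ 2 / n) + rate P M i * (1 / n))) ?_)
  · rw [ENNReal.toReal_add (ENNReal.add_ne_top.2 ⟨hprec i, h1 i⟩) (h2 i),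
      ENNReal.toReal_add (hprec i) (h1 i), ENNReal.toReal_mul, ENNReal.toReal_mul,
      precededMean_eq hM hpos hlt hψ hψcont i (ht'0.trans htt'), rate_mul_time,
      ENNReal.toReal_ofReal (by positivity)]
    have := mul_le_mul_of_nonneg_left hq (rate_pos hpos hlt i).le
    rw [rate] at this ⊢
    linarith
  · rw [Finset.sum_add_distrib, Finset.sum_add_distrib, ← Finset.sum_mul, ← Finset.sum_mul,
      add_mul, add_mul, mul_comm _ Λ, mul_comm _ Λ, mul_comm _ Λ, Finset.mul_sum]
    congr 2
    refine Finset.sum_congr rfl fun i _ => ?_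
    rw [popularity, ← hΛ]
    field_simp

lemma le_hitProbLRU (hψcont : Continuous (cdf ψ)) (hn : 0 < n) {ν ν' κ C : ℝ} (hν : 0 < ν)
    (hνν' : ν < ν') (hκ : 0 < κ)
    (hC : ∑ j, excessCdf ψ (ν' * (n * popularity P M j)) + κ * n ≤ C - 1) :
    ∑ i, popularity P M i * cdf ψ (ν * (n * popularity P M i)) ≤
      hitProbLRU P M C + 1 / κ ^ 2 / n := by
  set Λ := ∑ j, rate P M j with hΛ
  have hΛ0 : 0 < Λ := sum_rate_pos hpos hlt hn
  have hn' : (0 : ℝ) < n := by exact_mod_cast hn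
  set t := ν * n / Λ with ht
  set t' := ν' * n / Λ with ht'
  have htt' : t < t' := by rw [ht, ht']; gcongr
  have ht0 : 0 < t := by positivity
  obtain ⟨m, hm, hm2⟩ : ∃ m : ℕ, 0 < m ∧ 1 / (m : ℝ) ≤ t' - t := by
    have hinv : Tendsto (fun m : ℕ => 1 / (m : ℝ)) atTop (𝓝 0) :=
      tendsto_one_div_atTop_nhds_zero_nat
    exact ((eventually_gt_atTop 0).and (hinv.eventually_le_const (sub_pos.2 htt'))).exists
  have hm0 : (0 : ℝ) < 1 / m := by positivity
  set δ : ℝ≥0∞ := ENNReal.ofReal (1 / κ ^ 2 / n)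
  have hδ : ∀ a b : ℝ, b - a = t + 1 / m →
      P {ω | C - 1 ≤ activeCount Finset.univ (Ioc a b) (fun j => M j ω)} ≤ δ := by
    intro a b hab
    have h := measure_activeCount_deviation_le hM hind a b (c := κ * n) (by positivity)
    have e : (Fintype.card (Fin n) : ℝ) / (κ * n) ^ 2 = 1 / κ ^ 2 / n := by
      rw [Fintype.card_fin]
      field_simp
    rw [e] at h
    refine (measure_mono fun ω hω => ?_).trans h
    have hω' : C - 1 ≤ activeCount Finset.univ (Ioc a b) (fun j => M j ω) := hω
    have hsum : ∑ j, (hitWithin P (M j) (b - a)).toReal ≤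
        ∑ j, excessCdf ψ (ν' * (n * popularity P M j)) := by
      refine Finset.sum_le_sum fun j _ => ?_
      rw [hitWithin_eq hM hpos hlt hψ j (by linarith), ← rate_mul_time]
      refine monotone_excessCdf (mul_le_mul_of_nonneg_left ?_ (rate_pos hpos hlt j).le)
      linarith
    change κ * n ≤ |_|
    rw [le_abs]
    left
    linarith
  have hmass := le_hit_mass hM hind hm hδ
  have hfin := hit_mass_ne_top hM hlt C
  have hδtop : δ ≠ ⊤ := ENNReal.ofReal_ne_top
  have hItop : ∑ i, intensity P (M i) ≠ ⊤ := ENNReal.sum_ne_top.2 fun i _ => (hlt i).ne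
  have hmass' := ENNReal.toReal_mono
    (ENNReal.add_ne_top.2 ⟨hfin, ENNReal.mul_ne_top hItop hδtop⟩) hmass
  rw [ENNReal.toReal_sum fun i _ => ((IsStationaryErgodicSimple.precededMean_le t).trans_lt (hlt i)).ne,
    ENNReal.toReal_add hfin (ENNReal.mul_ne_top hItop hδtop), ENNReal.toReal_mul,
    ENNReal.toReal_ofReal (by positivity), toReal_sum_intensity hlt] at hmass'
  rw [hitProbLRU_eq hM, toReal_sum_intensity hlt, ← hΛ, ← mul_le_mul_iff_right₀ hΛ0, mul_add,
    mul_div_cancel₀ _ hΛ0.ne']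
  refine le_of_eq_of_le ?_ hmass'
  rw [Finset.mul_sum]
  refine Finset.sum_congr rfl fun i _ => ?_
  rw [precededMean_eq hM hpos hlt hψ hψcont i ht0, rate_mul_time, popularity, ← hΛ]
  field_simp

end FixedNumber

/-! ### The limit -/

lemma continuous_integral_mul_cdf {m : Measure ℝ} {f : ℝ → ℝ} (hf : Integrable f m)
    {ψ : Measure ℝ} (hψcont : Continuous (cdf ψ)) :
    Continuous fun ν => ∫ x, f x * cdf ψ (ν * f x) ∂m := by
  refine continuous_of_dominated (bound := fun x => ‖f x‖) (fun ν => ?_) (fun ν => ?_) hf.norm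
    (.of_forall fun x => ?_)
  · exact hf.aestronglyMeasurable.mul
      (hψcont.comp_aestronglyMeasurable (hf.aestronglyMeasurable.const_mul ν))
  · refine .of_forall fun x => ?_
    rw [norm_mul, Real.norm_of_nonneg (cdf_nonneg ψ _)]
    exact mul_le_of_le_one_right (norm_nonneg _) (cdf_le_one ψ _)
  · exact continuous_const.mul (hψcont.comp (continuous_mul_const (f x)))

lemma tendsto_const_div_nat_add (a : ℝ) (x : ℝ) {u : ℕ → ℝ} (hu : Tendsto u atTop (𝓝 x)) :
    Tendsto (fun n : ℕ => u n + a / n) atTop (𝓝 x) := by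
  simpa using hu.add (tendsto_const_div_atTop_nhds_zero_nat a)

end LRU

/-! ### The limit theorem -/

theorem mainTheorem4 {Ω : Type*} [MeasurableSpace Ω] (P : Measure Ω) [IsProbabilityMeasure P]
    (N : ∀ n : ℕ, Fin n → Ω → Measure ℝ) (hN : LRU.IsRequestModel P N)
    -- the cache sizes
    (C : ℕ → ℝ) (β₀ : ℝ) (hβ₀ : β₀ ∈ Ioo (0 : ℝ) 1)
    (hC : Asymptotics.IsEquivalent atTop C (fun n : ℕ => β₀ * n))
    -- the single scale family, generated by the cdf `Ψ = cdf ψ`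
    (ψ : Measure ℝ) [IsProbabilityMeasure ψ] (hψcont : Continuous (cdf ψ))
    (hψsupp : ∀ t < 0, cdf ψ t = 0)
    (hscale : ∀ n (i : Fin n) (t : ℝ), LRU.stdInterRequestCdf P (N n) i t = cdf ψ t)
    -- the popularities
    (f : ℝ → ℝ)
    (hf : LRU.FaginCondition (fun n => LRU.popularity P (N n)) (fun n => (n : ℝ)⁻¹) f)
    (hf_one : ∫ x in (0 : ℝ)..1, f x = 1) :
    ∃ ν₀ : ℝ,
      (0 < ν₀ ∧ ∫ x in (0 : ℝ)..1, LRU.hatCdf ψ (ν₀ * f x) = β₀) ∧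
      (∀ ν : ℝ, 0 < ν → ∫ x in (0 : ℝ)..1, LRU.hatCdf ψ (ν * f x) = β₀ → ν = ν₀) ∧
      Tendsto (fun n => LRU.hitProbLRU P (N n) (C n)) atTop
        (𝓝 (∫ x in (0 : ℝ)..1, f x * cdf ψ (ν₀ * f x))) := by
  have hpos := hN.intensity_pos
  have hlt := hN.intensity_lt_top
  have hlim1 : ∃ b : ℕ → ℝ, Tendsto b atTop atTop ∧
      Tendsto (fun k => LRU.excessCdf ψ (b k)) atTop (𝓝 1) := by
    -- All contents share the same `ψ`, so the single content of the model with `n = 1` suffices to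
    -- normalise `ψ`.
    refine ⟨fun k => LRU.rate P (N 1) 0 * (2 * k), ?_, ?_⟩
    · exact (tendsto_natCast_atTop_atTop.const_mul_atTop two_pos).const_mul_atTop
        (LRU.rate_pos (hpos 1) (hlt 1) 0)
    · refine ((hN.process 1 0).tendsto_hitWithin_atTop (hpos 1 0)).congr fun k => ?_
      exact LRU.hitWithin_eq (hN.process 1) (hpos 1) (hlt 1) (hscale 1) 0 (by positivity)
  obtain ⟨b, hb, hlim⟩ := hlim1
  have hhat : LRU.hatCdf ψ = LRU.excessCdf ψ := by
    ext t
    rw [LRU.hatCdf, LRU.integral_id_eq_one hb hlim hψsupp, div_one, one_mul, LRU.excessCdf]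
  rw [hhat]
  have hp (n : ℕ) (i : Fin n) : 0 < LRU.popularity P (N n) i :=
    LRU.popularity_pos (hpos n) (hlt n) i
  have hp_one (n : ℕ) (hn : 0 < n) : ∑ i, LRU.popularity P (N n) i = 1 :=
    LRU.sum_popularity (hpos n) (hlt n) hn
  have hfint : Integrable f (volume.restrict (Ioc 0 1)) :=
    (intervalIntegrable_iff_integrableOn_Ioc_of_le zero_le_one).1
      (intervalIntegral.intervalIntegrable_of_integral_ne_zero (by rw [hf_one]; exact one_ne_zero))
  have : IsProbabilityMeasure (volume.restrict (Ioc (0 : ℝ) 1)) := ⟨by simp⟩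
  have hI (g : ℝ → ℝ) : ∫ x in (0 : ℝ)..1, g x = ∫ x in Ioc 0 1, g x :=
    intervalIntegral.integral_of_le zero_le_one
  obtain ⟨ν₀, hν₀, hν₀β, hbelow, habove⟩ := LRU.exists_characteristic_time
    hfint.aestronglyMeasurable hf.2.1 (LRU.continuous_excessCdf (ψ := ψ)) LRU.excessCdf_zero
    LRU.monotone_excessCdf (LRU.excessCdf_le_one hb hlim) (LRU.tendsto_excessCdf hb hlim)
    (fun s t hst h => LRU.excessCdf_eq_one_of_eq hb hlim hst h) hβ₀
  simp only [← hI] at hν₀β hbelow habove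
  refine ⟨ν₀, ⟨hν₀, hν₀β⟩, fun ν hν h => ?_, ?_⟩
  · rcases lt_trichotomy ν ν₀ with hlt | heq | hgt
    · exact absurd h (hbelow ν hν.le hlt).ne
    · exact heq
    · exact absurd h (habove ν hgt).ne'
  have hcont := (LRU.continuous_integral_mul_cdf hfint hψcont).tendsto ν₀
  simp only [← hI] at hcont
  have hsum {ν : ℝ} : Tendsto (fun n : ℕ => ∑ i, LRU.popularity P (N n) i *
      cdf ψ (ν * (n * LRU.popularity P (N n) i))) atTop
      (𝓝 (∫ x in (0 : ℝ)..1, f x * cdf ψ (ν * f x))) :=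
    LRU.tendsto_weighted_sum_of_fagin (φ := fun t => cdf ψ (ν * t)) hp hf (by fun_prop)
      (fun t _ => by rw [abs_of_nonneg (cdf_nonneg ψ _)]; exact cdf_le_one ψ _) hf_one hp_one
  have havg {ν : ℝ} (hν : 0 < ν) : Tendsto (fun n : ℕ => (n : ℝ)⁻¹ * ∑ i,
      LRU.excessCdf ψ (ν * (n * LRU.popularity P (N n) i))) atTop
      (𝓝 (∫ x in (0 : ℝ)..1, LRU.excessCdf ψ (ν * f x))) :=
    LRU.tendsto_average_of_fagin (φ := fun t => LRU.excessCdf ψ (ν * t)) hp hf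
      (LRU.continuous_excessCdf.comp (continuous_const_mul ν)) fun t ht => by
        rw [abs_of_nonneg (LRU.excessCdf_nonneg (by positivity))]
        exact LRU.excessCdf_le_one hb hlim _
  have hCn : Tendsto (fun n : ℕ => C n / n) atTop (𝓝 β₀) := by
    obtain ⟨u, hu, hCu⟩ := hC.exists_eq_mul
    have h1 := hu.mul_const β₀
    rw [one_mul] at h1
    refine h1.congr' ?_
    filter_upwards [hCu, eventually_gt_atTop 0] with n hn hn0
    have hn' : (n : ℝ) ≠ 0 := by exact_mod_cast hn0.ne'
    rw [hn, Pi.mul_apply]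
    field_simp
  refine tendsto_order.2 ⟨fun a ha => ?_, fun a ha => ?_⟩
  -- Continuity in `ν` allows a slightly smaller window whose limit still exceeds `a`. The
  -- intermediate `ν'` leaves room for the cell length.
  · obtain ⟨ν, hνa, hν, hνν₀⟩ : ∃ ν, a < ∫ x in (0 : ℝ)..1, f x * cdf ψ (ν * f x) ∧
        0 < ν ∧ ν < ν₀ :=
      (((hcont.mono_left nhdsWithin_le_nhds).eventually_const_lt ha).and
        (Ioo_mem_nhdsLT hν₀)).exists
    obtain ⟨ν', hν', hν'ν₀⟩ := exists_between hνν₀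
    have hgap := hbelow ν' (hν.trans hν').le hν'ν₀
    set Φ := ∫ x in (0 : ℝ)..1, LRU.excessCdf ψ (ν' * f x)
    -- One third each for the Riemann-sum error, the Chebyshev deviation, and the error in `(C n -
    -- 1) / n`.
    set κ := (β₀ - Φ) / 3 with hκ
    have hκ0 : 0 < κ := by rw [hκ]; linarith
    have h1 := LRU.tendsto_const_div_nat_add (-1) _ hCn
    have h2 := LRU.tendsto_const_div_nat_add (-(1 / κ ^ 2)) _ (hsum (ν := ν))
    filter_upwards [eventually_gt_atTop 0,
      (havg (hν.trans hν')).eventually_lt_const (show Φ < Φ + κ by linarith),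
      h1.eventually_const_lt (show β₀ - κ < β₀ by linarith), h2.eventually_const_lt hνa]
      with n hn hn1 hn2 hn3
    have hn' : (0 : ℝ) < n := by exact_mod_cast hn
    have key := LRU.le_hitProbLRU (hN.process n) (hN.indep n) (hpos n) (hlt n) (hscale n) hψcont hn
      hν hν' hκ0 (C := C n) ?_
    · rw [neg_div] at hn3
      linarith
    · rw [← add_div, lt_div_iff₀ hn'] at hn2
      rw [inv_mul_lt_iff₀ hn'] at hn1
      have : Φ + κ + κ = β₀ - κ := by rw [hκ]; ring
      nlinarith
  · obtain ⟨ν, hνa, hνν₀⟩ : ∃ ν, ∫ x in (0 : ℝ)..1, f x * cdf ψ (ν * f x) < a ∧ ν₀ < ν :=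
      (((hcont.mono_left nhdsWithin_le_nhds).eventually_lt_const ha).and
        (self_mem_nhdsWithin (s := Ioi ν₀))).exists
    obtain ⟨ν', hν', hν'ν⟩ := exists_between hνν₀
    have hgap := habove ν' hν'
    set Φ := ∫ x in (0 : ℝ)..1, LRU.excessCdf ψ (ν' * f x)
    set κ := (Φ - β₀) / 3 with hκ
    have hκ0 : 0 < κ := by rw [hκ]; linarith
    have h1 := LRU.tendsto_const_div_nat_add 1 _ hCn
    have h2 := LRU.tendsto_const_div_nat_add 1 _
      (LRU.tendsto_const_div_nat_add (1 / κ ^ 2) _ (hsum (ν := ν)))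
    filter_upwards [eventually_gt_atTop 0,
      (havg (hν₀.trans hν')).eventually_const_lt (show Φ - κ < Φ by linarith),
      h1.eventually_lt_const (show β₀ < β₀ + κ by linarith), h2.eventually_lt_const hνa]
      with n hn hn1 hn2 hn3
    have hn' : (0 : ℝ) < n := by exact_mod_cast hn
    have key := LRU.hitProbLRU_le (hN.process n) (hN.indep n) (hpos n) (hlt n) (hscale n) hψcont hn
      (hν₀.trans hν') hν'ν hκ0 (C := C n) ?_
    · linarith
    · rw [← add_div, div_lt_iff₀ hn'] at hn2
      rw [lt_inv_mul_iff₀ hn'] at hn1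
      have : Φ - κ - κ = β₀ + κ := by rw [hκ]; ring
      nlinarith
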